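/- **Setting.** Let $W$ be a binary-input memoryless output-symmetric channel (BMSC) with transition densities $W(y\mid x)$, $x\in\{0,1\}$, with Shannon capacity $C\in(0,1)$ and Bhattacharyya parameter $Z=\sum_{y}\sqrt{W(y\mid 0)W(y\mid 1)}\in(0,1)$ (an integral if the output alphabet is not discrete). A binary linear code of block length $N$ and rate $R$ has minimum distance $d_{\min}(N,R)$, the least Hamming weight of a nonzero codeword. For transmission of a uniformly distributed codeword over $W$, $P_e^{\rm MAP}(N,R,W,L)$ is the block error probability under MAP decoding with list size $L\ge 1$, where an error is declared if and only if at least $L$ codewords other than the transmitted one have likelihood at least as large as that of the transmitted one. (For the binary erasure channel ${\rm BEC}(\varepsilon)$ this says that the number of codewords compatible with the received word is strictly bigger than $L$.) We write $P_e^{\rm MAP}(N,R,\varepsilon,L)$ if $W={\rm BEC}(\varepsilon)$. A polar code of block length $N=2^n$ and rate $R$ for $W$ is generated by $NR$ rows of $F^{\otimes n}$, $F=\begin{pmatrix}1&0\\1&1\end{pmatrix}$, whose synthetic channels $W_N^{(i)}$ have the $NR$ smallest Bhattacharyya parameters. For $P\in(0,1)$ put $$\bar m(Z,P)=\log_2\left(\frac{2\ln(P/8)\,\ln(1-Z)}{\ln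 Z\cdot\ln\bigl(1-Z^{4\ln(P/8)/\ln Z}\bigr)}\right),$$ $$\bar n(Z,C,P)=2\bar m(Z,P)-\ln(1-C)+\sqrt{-4\,\bar m(Z,P)\ln(1-C)+(\ln(1-C))^2}.$$ **Corollary (DI bound, any $L$).** (a) Fix $P_e\in(0,1)$ and let $P_e(1)=P_e$ and $P_e(m+1)=\frac{3}{16}\bigl(P_e(m)\bigr)^2$ for $m\ge 1$. Let $L\ge 1$, and consider transmission over $W$ either with a binary linear code of block length $N$ and rate $R$ such that $$P_e^{\rm MAP}(N,R,W,L)>P_e(L)\quad\text{and}\quad d_{\min}(N,R)>\frac{\ln(P_e(L)/8)}{\ln Z},$$ or with a polar code for $W$ of block length $N$ and rate $R$ such that $$N>2^{\bar n(Z,C,P_e(L))}\quad\text{and}\quad P_e^{\rm MAP}(N,R,W,L)>P_e(L).$$ Then $$P_e^{\rm MAP}(N,R,W,L+1)\ \ge\ \Bigl(\frac{3}{16}\Bigr)^{2^L-1}\bigl(P_e^{\rm MAP}(N,R,W,1)\bigr)^{2^L}.$$ (b) Let $W={\rm BEC}(\varepsilon)$ with $\varepsilon\in(0,1)$, let $P_e\in(0,1)$,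 $P_e(0)=P_e$ and $P_e(m+1)=\frac{3}{16}\bigl(P_e(m)\bigr)^2$ for $m\ge 0$, and let $L\ge 1$ be a power of $2$. If a binary linear code, respectively a polar code for $W$, satisfies the conditions of (a) with $P_e(\log_2 L)$ in place of $P_e(L)$, then $$P_e^{\rm MAP}(N,R,\varepsilon,2L)\ \ge\ \Bigl(\frac{3}{16}\Bigr)^{2L-1}\bigl(P_e^{\rm MAP}(N,R,\varepsilon,1)\bigr)^{2L}.$$ -/

import Mathlib

open MeasureTheory Set
open scoped ENNReal NNReal

universe u

/-- A binary-input memoryless channel with output alphabet `Y` (discrete or not), given by its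
transition densities: `p x y` is the density `W(y | x)` of the output `y`, given the input `x`,
with respect to the reference measure `ref` (the counting measure for a discrete alphabet). -/
structure BinaryChannel (Y : Type u) [MeasurableSpace Y] where
  ref : Measure Y
  sigmaFinite_ref : SigmaFinite ref
  p : ZMod 2 → Y → ℝ≥0
  measurable_p : ∀ x, Measurable (p x)
  lintegral_p : ∀ x, ∫⁻ y, (p x y : ℝ≥0∞) ∂ref = 1

namespace BinaryChannel

attribute [instance] BinaryChannel.sigmaFinite_ref

variable {Y : Type u} [MeasurableSpace Y]

/-- Output-symmetry: some involution `π` of the output alphabet (compatible with the reference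
measure) satisfies `W(y | 1) = W(π y | 0)`. -/
def IsSymmetric (W : BinaryChannel Y) : Prop :=
  ∃ π : Y → Y, Function.Involutive π ∧ MeasurePreserving π W.ref W.ref ∧
    ∀ y, W.p 1 y = W.p 0 (π y)

/-- The Bhattacharyya parameter `Z(W) = ∑_y √(W(y|0) W(y|1))`. -/
noncomputable def bhattacharyya (W : BinaryChannel Y) : ℝ :=
  ∫ y, √((W.p 0 y : ℝ) * (W.p 1 y : ℝ)) ∂W.ref

/-- The mutual information (in bits) between input and output when the input is `1` with
probability `q` and `0` with probability `1 - q`. -/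
noncomputable def mutualInformation (W : BinaryChannel Y) (q : ℝ) : ℝ :=
  ∫ y, ((1 - q) * W.p 0 y * Real.logb 2 (W.p 0 y / ((1 - q) * W.p 0 y + q * W.p 1 y)) +
    q * W.p 1 y * Real.logb 2 (W.p 1 y / ((1 - q) * W.p 0 y + q * W.p 1 y))) ∂W.ref

/-- The Shannon capacity, i.e. the maximal mutual information over all input distributions. -/
noncomputable def capacity (W : BinaryChannel Y) : ℝ :=
  ⨆ q : Icc (0 : ℝ) 1, W.mutualInformation q

/-- The likelihood `p(y | x) = ∏ i, W(y_i | x_i)` of an input block `x` for the output `y`. -/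
def likelihood (W : BinaryChannel Y) {ι : Type*} [Fintype ι] (x : ι → ZMod 2) (y : ι → Y) : ℝ≥0 :=
  ∏ i, W.p (x i) (y i)

/-- The law of the channel output when the input block `x` is sent by independent channel uses. -/
noncomputable def outputLaw (W : BinaryChannel Y) {ι : Type*} [Fintype ι] (x : ι → ZMod 2) :
    Measure (ι → Y) :=
  Measure.pi fun i => W.ref.withDensity fun y => (W.p (x i) y : ℝ≥0∞)

/-- The outputs at which MAP decoding with list size `L` declares an error when the codeword `c` of
the code `C` is sent: at least `L` other codewords are at least as likely as `c`. -/
def mapErrorEvent (W : BinaryChannel Y) {ι : Type*} [Fintype ι]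
    (C : Submodule (ZMod 2) (ι → ZMod 2)) (L : ℕ) (c : ι → ZMod 2) : Set (ι → Y) :=
  {y | L ≤ Set.ncard {c' : ι → ZMod 2 | c' ∈ C ∧ c' ≠ c ∧ W.likelihood c y ≤ W.likelihood c' y}}

open Classical in
/-- The block error probability `P_e^MAP` of the linear code `C` under MAP decoding with list size
`L`; the transmitted codeword is uniformly distributed on `C`. -/
noncomputable def mapErrorProb (W : BinaryChannel Y) {ι : Type*} [Fintype ι]
    (C : Submodule (ZMod 2) (ι → ZMod 2)) (L : ℕ) : ℝ :=
  (∑ c : ι → ZMod 2 with c ∈ C, (W.outputLaw c).real (W.mapErrorEvent C L c)) / (Nat.card C : ℝ)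

theorem lintegral_half_mul_prod (W : BinaryChannel Y) (a b : ZMod 2) :
    ∫⁻ z, (((1 / 2) * (W.p a z.1 * W.p b z.2) : ℝ≥0) : ℝ≥0∞) ∂W.ref.prod W.ref = 2⁻¹ := by
  have ha := (W.measurable_p a).coe_nnreal_ennreal
  have hb := (W.measurable_p b).coe_nnreal_ennreal
  have h : ∀ z : Y × Y, (((1 / 2) * (W.p a z.1 * W.p b z.2) : ℝ≥0) : ℝ≥0∞)
      = 2⁻¹ * ((W.p a z.1 : ℝ≥0∞) * (W.p b z.2 : ℝ≥0∞)) := by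
    intro z
    simp
  simp_rw [h]
  have hm : Measurable fun z : Y × Y => (W.p a z.1 : ℝ≥0∞) * (W.p b z.2 : ℝ≥0∞) :=
    (ha.comp measurable_fst).mul (hb.comp measurable_snd)
  rw [lintegral_const_mul _ hm, lintegral_prod_mul ha.aemeasurable hb.aemeasurable, W.lintegral_p, W.lintegral_p]
  simp

theorem measurable_half_mul (W : BinaryChannel Y) (a b : ZMod 2) :
    Measurable fun z : Y × Y => (1 / 2 : ℝ≥0) * (W.p a z.1 * W.p b z.2) :=
  (((W.measurable_p a).comp measurable_fst).mul ((W.measurable_p b).comp measurable_snd)).const_mul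
    _

/-- The channel `W⁻`: two copies of `W` are fed with `u₁ + u₂` and `u₂`; the input is `u₁`, the
output is `(y₁, y₂)`, and `u₂` is uniform. -/
noncomputable def minus (W : BinaryChannel Y) : BinaryChannel (Y × Y) where
  ref := W.ref.prod W.ref
  sigmaFinite_ref := inferInstance
  p u₁ z := ∑ u₂ : ZMod 2, (1 / 2) * (W.p (u₁ + u₂) z.1 * W.p u₂ z.2)
  measurable_p u₁ := Finset.measurable_fun_sum _ fun u₂ _ => W.measurable_half_mul (u₁ + u₂) u₂
  lintegral_p u₁ := by
    simp only [ENNReal.ofNNReal_finsetSum]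
    rw [lintegral_finsetSum _ (fun u₂ _ => (W.measurable_half_mul (u₁ + u₂) u₂).coe_nnreal_ennreal)]
    simp only [lintegral_half_mul_prod]
    simp [ENNReal.mul_inv_cancel]

/-- The channel `W⁺`: two copies of `W` are fed with `u₁ + u₂` and `u₂`; the input is `u₂`, the
output is `(y₁, y₂, u₁)`, and `u₁` is uniform. -/
noncomputable def plus (W : BinaryChannel Y) : BinaryChannel ((Y × Y) × ZMod 2) where
  ref := (W.ref.prod W.ref).prod Measure.count
  sigmaFinite_ref := inferInstance
  p u₂ z := (1 / 2) * (W.p (z.2 + u₂) z.1.1 * W.p u₂ z.1.2)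
  measurable_p u₂ :=
    measurable_from_prod_countable_left fun u => W.measurable_half_mul (u + u₂) u₂
  lintegral_p u₂ := by
    rw [lintegral_prod_symm]
    · simp only [lintegral_half_mul_prod]
      simp [ENNReal.inv_mul_cancel]
    · exact (Measurable.coe_nnreal_ennreal (measurable_from_prod_countable_left
        fun u => W.measurable_half_mul (u + u₂) u₂)).aemeasurable

/-- The Bhattacharyya parameter of the synthetic channel `W_N^{(i)}`, `N = 2 ^ n`, where `b` is the
binary expansion of `i - 1`, most significant bit first: starting from `W` and reading `b` from the
left, a bit `0` applies `V ↦ V⁻` and a bit `1` applies `V ↦ V⁺`. -/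
noncomputable def syntheticBhattacharyya : (n : ℕ) → (Fin n → Fin 2) →
    {Y : Type u} → [MeasurableSpace Y] → BinaryChannel Y → ℝ
  | 0, _, _, _, W => W.bhattacharyya
  | n + 1, b, _, _, W =>
      if b 0 = 0 then syntheticBhattacharyya n (Fin.tail b) W.minus
      else syntheticBhattacharyya n (Fin.tail b) W.plus

end BinaryChannel

/-- The outputs of the binary erasure channel: an input bit, or the erasure symbol `none`. -/
abbrev ErasureOutput : Type := Option (ZMod 2)

instance : MeasurableSpace ErasureOutput := ⊤

/-- The binary erasure channel `BEC(ε)`: the input is erased with probability `ε`. -/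
noncomputable def binaryErasureChannel (ε : ℝ) (hε : ε ∈ Ioo (0 : ℝ) 1) :
    BinaryChannel ErasureOutput where
  ref := Measure.count
  sigmaFinite_ref := inferInstance
  p x y := match y with
    | none => ε.toNNReal
    | some b => if b = x then (1 - ε).toNNReal else 0
  measurable_p _ := measurable_from_top
  lintegral_p x := by
    have h : ε.toNNReal + (1 - ε).toNNReal = 1 := by
      rw [← Real.toNNReal_add hε.1.le (sub_nonneg.2 hε.2.le)]
      simp
    rw [lintegral_count' measurable_from_top, tsum_fintype, Fintype.sum_option,
      Finset.sum_eq_single x (fun b _ hb => by simp [hb]) (by simp)]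
    change (ε.toNNReal : ℝ≥0∞) + ((if x = x then (1 - ε).toNNReal else 0 : ℝ≥0) : ℝ≥0∞) = 1
    rw [if_pos rfl]
    exact_mod_cast h

/-- The minimum distance of a linear code: the smallest Hamming weight of a nonzero codeword. -/
noncomputable def minDistance {ι : Type*} [Fintype ι] (C : Submodule (ZMod 2) (ι → ZMod 2)) : ℕ :=
  sInf {d | ∃ c ∈ C, c ≠ 0 ∧ hammingNorm c = d}

/-- The `n`-th Kronecker power of `F = [1 0; 1 1]`; rows and columns are labelled by the binary
expansions, most significant bit first, of `0, …, 2 ^ n - 1`. -/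
def polarMatrix (n : ℕ) : Matrix (Fin n → Fin 2) (Fin n → Fin 2) (ZMod 2) :=
  fun b x => ∏ j, (!![1, 0; 1, 1] : Matrix (Fin 2) (Fin 2) (ZMod 2)) (b j) (x j)

/-- `C` is a polar code of block length `2 ^ n` for the channel `W`: it is generated by those rows
of `F^{⊗ n}` (as many as its dimension) whose synthetic channels have the smallest Bhattacharyya
parameters. -/
def IsPolarCode {Y : Type u} [MeasurableSpace Y] (W : BinaryChannel Y) (n : ℕ)
    (C : Submodule (ZMod 2) ((Fin n → Fin 2) → ZMod 2)) : Prop :=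
  ∃ A : Set (Fin n → Fin 2),
    (∀ i ∈ A, ∀ j ∉ A, W.syntheticBhattacharyya n i ≤ W.syntheticBhattacharyya n j) ∧
    C = Submodule.span (ZMod 2) (polarMatrix n '' A)

/-- The quantity `m̄(Z, P)` in the condition on the block length of polar codes. -/
noncomputable def mBar (Z P : ℝ) : ℝ :=
  Real.logb 2 ((2 * Real.log (P / 8) * Real.log (1 - Z)) /
    (Real.log Z * Real.log (1 - Z ^ ((4 * Real.log (P / 8)) / Real.log Z))))

/-- The quantity `n̄(Z, C, P)` in the condition `N > 2 ^ n̄` on the block length of polar codes. -/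
noncomputable def nBar (Z C P : ℝ) : ℝ :=
  2 * mBar Z P - Real.log (1 - C) +
    √(-4 * mBar Z P * Real.log (1 - C) + Real.log (1 - C) ^ 2)

/-! By output symmetry the zero codeword may be taken as transmitted. The decoder then depends only
on the vector of likelihood ratios W(y_i|1)/W(y_i|0), whose coordinates are independent, and `c`
beats 0 exactly when the product of the ratios over the support of `c` is at least 1. This is an
increasing event, so Harris' inequality makes all such events, their unions and their intersections,
positively correlated.

Divide and intersect: list-`m` failure is the union, over `m`-sets of nonzero codewords, of the
events that the whole set beats 0. If each of these has at most an eighth of the probability q of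
the union, the family splits into two parts with unions of probability at least 3q/8 and q/2. By
Harris both unions occur together with probability at least 3q²/16, and then two different `m`-sets,
hence `m + 1` codewords, beat 0. Iterating from list size 1 gives (a). Over the erasure channel the
codewords that beat 0 form, with 0, a linear space; subspaces of dimension l + 1 replace the
`m`-sets, and each step doubles the list size. The smallness condition follows from the
Bhattacharyya bound Z^{wt(c)} and the minimum distance.

For polar codes there is a dichotomy (`polar_dichotomy`). The selected index set is an upper set,
because turning a minus into a plus transform strictly lowers the Bhattacharyya parameter. If all
selected rows are heavy, the code lies in a Reed–Muller code and its minimum distance is large.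
Otherwise a light row `b` is selected, and the code contains the indicators of all translates of a
small subcube. These have disjoint supports, so their confusion events are independent; each has
probability at least Z^{2 wt}/4, and for N > 2^n̄ there are so many that, by Chebyshev, list
decoding fails with probability at least 1/2. This exceeds the claimed lower bound, which is at most
3/16. -/

/-! ### Correlation inequalities and the second-moment method -/

/-- Chebyshev's association inequality on a linear order. -/
theorem lintegral_mul_le_of_monotone {α : Type*} [LinearOrder α] [MeasurableSpace α]
    (μ : Measure α) [IsProbabilityMeasure μ] {f g : α → ℝ≥0∞} (hf : Monotone f) (hg : Monotone g)
    (hfm : Measurable f) (hgm : Measurable g) :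
    (∫⁻ x, f x ∂μ) * ∫⁻ x, g x ∂μ ≤ ∫⁻ x, f x * g x ∂μ := by
  -- The subtraction-free form of (f x − f y)(g x − g y) ≥ 0; it is then integrated over two
  -- independent copies of the variable.
  have key : ∀ a b c d : ℝ≥0∞, a ≤ b → c ≤ d → a * d + b * c ≤ a * c + b * d := by
    intro a b c d hab hcd
    obtain ⟨e, rfl⟩ := exists_add_of_le hab
    obtain ⟨k, rfl⟩ := exists_add_of_le hcd
    calc a * (c + k) + (a + e) * c = a * c + (a * (c + k) + e * c) := by ring
      _ ≤ a * c + (a * (c + k) + e * (c + k)) := by gcongr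
      _ = a * c + (a + e) * (c + k) := by ring
  have hpt : ∀ x y, f x * g y + f y * g x ≤ f x * g x + f y * g y := by
    intro x y
    rcases le_total x y with h | h
    · exact key _ _ _ _ (hf h) (hg h)
    · rw [add_comm, add_comm (f x * g x)]
      exact key _ _ _ _ (hf h) (hg h)
  have hint : ∫⁻ x, ∫⁻ y, (f x * g y + f y * g x) ∂μ ∂μ ≤
      ∫⁻ x, ∫⁻ y, (f x * g x + f y * g y) ∂μ ∂μ :=
    lintegral_mono fun x => lintegral_mono fun y => hpt x y
  have hl : ∫⁻ x, ∫⁻ y, (f x * g y + f y * g x) ∂μ ∂μ =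
      2 * ((∫⁻ x, f x ∂μ) * ∫⁻ x, g x ∂μ) := by
    have : ∀ x, ∫⁻ y, (f x * g y + f y * g x) ∂μ =
        f x * (∫⁻ y, g y ∂μ) + (∫⁻ y, f y ∂μ) * g x := fun x => by
      rw [lintegral_add_left (hgm.const_mul _), lintegral_const_mul _ hgm,
        lintegral_mul_const _ hfm]
    simp_rw [this]
    rw [lintegral_add_left (hfm.mul_const _), lintegral_mul_const _ hfm,
      lintegral_const_mul _ hgm, two_mul]
  have hr : ∫⁻ x, ∫⁻ y, (f x * g x + f y * g y) ∂μ ∂μ = 2 * ∫⁻ x, f x * g x ∂μ := by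
    have : ∀ x, ∫⁻ y, (f x * g x + f y * g y) ∂μ = f x * g x + ∫⁻ y, f y * g y ∂μ := fun x => by
      rw [lintegral_add_left measurable_const, lintegral_const, measure_univ, mul_one]
    simp_rw [this]
    rw [lintegral_add_left (by exact hfm.mul hgm), lintegral_const, measure_univ, mul_one, two_mul]
  rw [hl, hr] at hint
  exact (ENNReal.mul_le_mul_iff_right two_ne_zero ENNReal.ofNat_ne_top).1 hint

/-- Harris' inequality for functions on a finite product of linearly ordered probability spaces. -/
theorem harris_lintegral {ι α : Type*} [Fintype ι] [LinearOrder α] [MeasurableSpace α]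
    (μ : ι → Measure α) [∀ i, IsProbabilityMeasure (μ i)] {f g : (ι → α) → ℝ≥0∞}
    (hf : Monotone f) (hg : Monotone g) (hfm : Measurable f) (hgm : Measurable g) :
    (∫⁻ x, f x ∂Measure.pi μ) * ∫⁻ x, g x ∂Measure.pi μ ≤ ∫⁻ x, f x * g x ∂Measure.pi μ := by
  classical
  have hmono : ∀ {h : (ι → α) → ℝ≥0∞}, Monotone h → ∀ s : Finset ι,
      Monotone (lmarginal μ s h) := by
    intro h hh s x y hxy
    refine lintegral_mono fun z => hh fun i => ?_
    simp only [Function.updateFinset]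
    split_ifs
    · exact le_rfl
    · exact hxy i
  -- Coordinates are integrated out one at a time: partial integrals of monotone functions stay
  -- monotone, so the one-dimensional inequality applies to each further coordinate.
  have main : ∀ (s : Finset ι) (x : ι → α), lmarginal μ s f x * lmarginal μ s g x ≤
      lmarginal μ s (fun z => f z * g z) x := by
    intro s
    induction s using Finset.induction_on with
    | empty => intro x; simp
    | insert i s hi ih =>
      intro x
      rw [lmarginal_insert f hfm hi, lmarginal_insert g hgm hi,
        lmarginal_insert (fun z => f z * g z) (hfm.mul hgm) hi]
      have hup : Monotone fun t : α => Function.update x i t := by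
        intro a b h j
        by_cases hj : j = i
        · subst hj; simpa using h
        · simp [hj]
      refine (lintegral_mul_le_of_monotone (μ i) ((hmono hf s).comp hup) ((hmono hg s).comp hup)
        ((hfm.lmarginal μ).comp (measurable_update x))
        ((hgm.lmarginal μ).comp (measurable_update x))).trans ?_
      exact lintegral_mono fun t => ih _
  rcases isEmpty_or_nonempty (ι → α) with h | ⟨⟨x⟩⟩
  · simp [Measure.eq_zero_of_isEmpty]
  · simpa using main Finset.univ x

/-- Harris' inequality for upper sets. -/
theorem harris_measureReal {ι α : Type*} [Fintype ι] [LinearOrder α] [MeasurableSpace α]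
    (μ : ι → Measure α) [∀ i, IsProbabilityMeasure (μ i)] {A B : Set (ι → α)}
    (hA : IsUpperSet A) (hB : IsUpperSet B) (hAm : MeasurableSet A) (hBm : MeasurableSet B) :
    (Measure.pi μ).real A * (Measure.pi μ).real B ≤ (Measure.pi μ).real (A ∩ B) := by
  have hmono : ∀ {S : Set (ι → α)}, IsUpperSet S → Monotone (S.indicator (1 : (ι → α) → ℝ≥0∞)) := by
    intro S hS x y hxy
    by_cases hx : x ∈ S
    · simp [hx, hS hxy hx]
    · simp [hx]
  have h := harris_lintegral μ (hmono hA) (hmono hB) (measurable_one.indicator hAm)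
    (measurable_one.indicator hBm)
  have hmul : ∀ x, A.indicator (1 : (ι → α) → ℝ≥0∞) x * B.indicator (1 : (ι → α) → ℝ≥0∞) x =
      (A ∩ B).indicator (1 : (ι → α) → ℝ≥0∞) x := fun x => by
    rw [inter_indicator_one]; rfl
  simp_rw [hmul] at h
  rw [lintegral_indicator_one hAm, lintegral_indicator_one hBm,
    lintegral_indicator_one (hAm.inter hBm)] at h
  rw [measureReal_def, measureReal_def, measureReal_def, ← ENNReal.toReal_mul]
  exact ENNReal.toReal_mono (measure_ne_top _ _) h

/-- Divide and intersect: if none of the finitely many upper sets `E s` carries more than an eighth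
of the measure of their union, then with sizable probability two of them occur together. -/
theorem divide_and_intersect {ι α κ : Type*} [Fintype ι] [LinearOrder α] [MeasurableSpace α]
    (μ : ι → Measure α) [∀ i, IsProbabilityMeasure (μ i)] (T : Finset κ) (E : κ → Set (ι → α))
    (hE : ∀ s ∈ T, IsUpperSet (E s)) (hEm : ∀ s ∈ T, MeasurableSet (E s))
    (hsmall : ∀ s ∈ T, (Measure.pi μ).real (E s) ≤ (Measure.pi μ).real (⋃ s ∈ T, E s) / 8)
    {F : Set (ι → α)} (hF : ∀ s ∈ T, ∀ t ∈ T, s ≠ t → E s ∩ E t ⊆ F) :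
    3 / 16 * (Measure.pi μ).real (⋃ s ∈ T, E s) ^ 2 ≤ (Measure.pi μ).real F := by
  classical
  set ρ := Measure.pi μ with hρ
  set q := ρ.real (⋃ s ∈ T, E s) with hq
  have hq0 : 0 ≤ q := measureReal_nonneg
  -- A largest subfamily whose union has at most half of the probability: one more event pushes it
  -- over q/2, while the remaining events must cover at least q/2.
  let 𝒮 := T.powerset.filter fun S => ρ.real (⋃ s ∈ S, E s) ≤ q / 2
  have hne : 𝒮.Nonempty := ⟨∅, by simp [𝒮]; linarith⟩
  obtain ⟨S, hS, hmax⟩ := Finset.exists_max_image 𝒮 Finset.card hne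
  obtain ⟨hST, hSq⟩ := Finset.mem_filter.1 hS
  rw [Finset.mem_powerset] at hST
  have hsplit : (⋃ s ∈ T, E s) = (⋃ s ∈ S, E s) ∪ ⋃ s ∈ T \ S, E s := by
    rw [← Finset.set_biUnion_union, Finset.union_sdiff_of_subset hST]
  have hsub : q ≤ ρ.real (⋃ s ∈ S, E s) + ρ.real (⋃ s ∈ T \ S, E s) := by
    rw [hq, hsplit]; exact measureReal_union_le _ _
  rcases Finset.eq_empty_or_nonempty (T \ S) with hemp | ⟨s, hs⟩
  · have : q = 0 := by
      rw [hemp] at hsub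
      simp at hsub
      linarith
    rw [this]
    simp
  · obtain ⟨hsT, hsS⟩ := Finset.mem_sdiff.1 hs
    have hlarge : q / 2 < ρ.real (⋃ t ∈ insert s S, E t) := by
      by_contra! hcon
      have hmem : insert s S ∈ 𝒮 :=
        Finset.mem_filter.2 ⟨Finset.mem_powerset.2 (Finset.insert_subset hsT hST), hcon⟩
      have := hmax _ hmem
      rw [Finset.card_insert_of_notMem hsS] at this
      omega
    -- 3/8 = 1/2 − 1/8, since the added event costs at most q/8.
    have h38 : 3 / 8 * q ≤ ρ.real (⋃ t ∈ S, E t) := by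
      rw [Finset.set_biUnion_insert] at hlarge
      have h1 := measureReal_union_le (μ := ρ) (E s) (⋃ t ∈ S, E t)
      have h2 := hsmall s hsT
      linarith
    have h12 : q / 2 ≤ ρ.real (⋃ t ∈ T \ S, E t) := by linarith
    have hU : ∀ S' ⊆ T, IsUpperSet (⋃ t ∈ S', E t) := fun S' h' =>
      isUpperSet_iUnion₂ fun t ht => hE t (h' ht)
    have hM : ∀ S' ⊆ T, MeasurableSet (⋃ t ∈ S', E t) := fun S' h' =>
      Finset.measurableSet_biUnion _ fun t ht => hEm t (h' ht)
    have hh := harris_measureReal μ (hU S hST) (hU _ Finset.sdiff_subset) (hM S hST)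
      (hM (T \ S) Finset.sdiff_subset)
    have hF' : (⋃ t ∈ S, E t) ∩ (⋃ t ∈ T \ S, E t) ⊆ F := by
      rintro x ⟨hx1, hx2⟩
      simp only [mem_iUnion] at hx1 hx2
      obtain ⟨a, ha, hxa⟩ := hx1
      obtain ⟨b, hb, hxb⟩ := hx2
      obtain ⟨hbT, hbS⟩ := Finset.mem_sdiff.1 hb
      exact hF a (hST ha) b hbT (by rintro rfl; exact hbS ha) ⟨hxa, hxb⟩
    calc 3 / 16 * q ^ 2 = (3 / 8 * q) * (q / 2) := by ring
      _ ≤ ρ.real (⋃ t ∈ S, E t) * ρ.real (⋃ t ∈ T \ S, E t) := by gcongr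
      _ ≤ _ := hh
      _ ≤ ρ.real F := measureReal_mono hF'

/-- A second-moment bound: if the events `E s` are pairwise independent and their probabilities
add up to at least `4 * k > 0`, then with probability at least `1 / 2` at least `k` of them occur. -/
theorem half_le_measureReal_card {Ω κ : Type*} [MeasurableSpace Ω] (ρ : Measure Ω)
    [IsProbabilityMeasure ρ] (T : Finset κ) (E : κ → Set Ω) (hEm : ∀ s ∈ T, MeasurableSet (E s))
    (hind : ∀ s ∈ T, ∀ t ∈ T, s ≠ t → ProbabilityTheory.IndepFun
      ((E s).indicator (1 : Ω → ℝ)) ((E t).indicator (1 : Ω → ℝ)) ρ)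
    {k : ℕ} (hk : 1 ≤ k) (hsum : 4 * (k : ℝ) ≤ ∑ s ∈ T, ρ.real (E s)) {F : Set Ω}
    (hF : ∀ x, (∃ S ⊆ T, S.card = k ∧ ∀ s ∈ S, x ∈ E s) → x ∈ F) :
    1 / 2 ≤ ρ.real F := by
  classical
  let X : κ → Ω → ℝ := fun s => (E s).indicator 1
  have hX : ∀ s ∈ T, MemLp (X s) 2 ρ := fun s hs =>
    memLp_indicator_const 2 (hEm s hs) 1 (Or.inr (measure_ne_top _ _))
  have hEX : ∀ s ∈ T, ∫ ω, X s ω ∂ρ = ρ.real (E s) := fun s hs => integral_indicator_one (hEm s hs)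
  have hvar : ProbabilityTheory.variance (∑ s ∈ T, X s) ρ ≤ ∑ s ∈ T, ρ.real (E s) := by
    rw [ProbabilityTheory.IndepFun.variance_sum hX]
    · refine Finset.sum_le_sum fun s hs => ?_
      refine (ProbabilityTheory.variance_le_expectation_sq (hX s hs).1).trans (le_of_eq ?_)
      rw [← hEX s hs]
      refine integral_congr_ae (Filter.Eventually.of_forall fun ω => ?_)
      by_cases h : ω ∈ E s <;> simp [X, h]
    · intro s hs t ht hst
      exact hind s hs t ht hst
  set m := ∑ s ∈ T, ρ.real (E s) with hm
  have hk' : (1 : ℝ) ≤ k := by exact_mod_cast hk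
  have hmean : ∫ ω, (∑ s ∈ T, X s) ω ∂ρ = m := by
    simp only [Finset.sum_apply]
    rw [integral_finsetSum _ fun s hs => (hX s hs).integrable one_le_two]
    exact Finset.sum_congr rfl hEX
  -- Fewer than k ≤ m/4 occurrences means a deviation of more than 3m/4 from the mean m. As the
  -- variance is at most m and m ≥ 4, this has probability at most 16/(9m) ≤ 4/9.
  have hcheb := ProbabilityTheory.meas_ge_le_variance_div_sq (memLp_finsetSum' T hX)
    (c := 3 / 4 * m) (by linarith)
  rw [hmean] at hcheb
  have hsub : Fᶜ ⊆ {ω | 3 / 4 * m ≤ |(∑ s ∈ T, X s) ω - m|} := by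
    intro ω hω
    have hcard : ((T.filter fun s => ω ∈ E s).card : ℝ) = (∑ s ∈ T, X s) ω := by
      rw [Finset.sum_apply, Finset.card_filter]
      push_cast
      refine Finset.sum_congr rfl fun s _ => ?_
      by_cases h : ω ∈ E s <;> simp [X, h]
    have hlt : (T.filter fun s => ω ∈ E s).card < k := by
      by_contra! hcon
      obtain ⟨S, hS, hSk⟩ := Finset.exists_subset_card_eq hcon
      exact hω (hF ω ⟨S, hS.trans (Finset.filter_subset _ _), hSk,
        fun s hs => (Finset.mem_filter.1 (hS hs)).2⟩)
    have hlt' : (∑ s ∈ T, X s) ω < k := by rw [← hcard]; exact_mod_cast hlt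
    rw [mem_ofPred_eq, abs_sub_comm]
    exact le_trans (by linarith) (le_abs_self _)
  have hle : ρ.real Fᶜ ≤ 1 / 2 := by
    have h1 : ρ.real {ω | 3 / 4 * m ≤ |(∑ s ∈ T, X s) ω - m|} ≤
        ProbabilityTheory.variance (∑ s ∈ T, X s) ρ / (3 / 4 * m) ^ 2 :=
      ENNReal.toReal_le_of_le_ofReal (div_nonneg (ProbabilityTheory.variance_nonneg _ _)
        (sq_nonneg _)) hcheb
    refine (measureReal_mono hsub).trans (h1.trans ?_)
    rw [div_le_iff₀ (by nlinarith)]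
    nlinarith
  have huniv : (1 : ℝ) ≤ ρ.real F + ρ.real Fᶜ := by
    have := measureReal_union_le (μ := ρ) F Fᶜ
    rwa [union_compl_self, probReal_univ] at this
  linarith

/-! ### Product densities and the Bhattacharyya coefficient -/

theorem lintegral_pi_prod {ι Y : Type*} [Fintype ι] [MeasurableSpace Y] (μ : ι → Measure Y)
    [∀ i, SigmaFinite (μ i)] (f : ι → Y → ℝ≥0∞) (hf : ∀ i, Measurable (f i)) :
    ∫⁻ y, ∏ i, f i (y i) ∂Measure.pi μ = ∏ i, ∫⁻ t, f i t ∂μ i := by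
  classical
  have hm : Measurable fun y : ι → Y => ∏ i, f i (y i) :=
    Finset.measurable_fun_prod _ fun i _ => (hf i).comp (measurable_pi_apply i)
  have main : ∀ (s : Finset ι) (x : ι → Y), lmarginal μ s (fun y => ∏ i, f i (y i)) x =
      (∏ i ∈ s, ∫⁻ t, f i t ∂μ i) * ∏ i ∈ sᶜ, f i (x i) := by
    intro s
    induction s using Finset.induction_on with
    | empty => intro x; simp
    | insert i s hi ih =>
      intro x
      rw [lmarginal_insert _ hm hi]
      have hc : sᶜ = insert i (insert i s)ᶜ := by
        ext j
        by_cases hj : j = i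
        · subst hj; simp [hi]
        · simp [hj]
      have hupd : ∀ t, ∏ j ∈ (insert i s)ᶜ, f j (Function.update x i t j) =
          ∏ j ∈ (insert i s)ᶜ, f j (x j) := fun t =>
        Finset.prod_congr rfl fun j hj => by
          rw [Function.update_of_ne]
          rintro rfl
          simp at hj
      simp_rw [ih, hc]
      have hni : i ∉ (insert i s)ᶜ := by simp
      simp_rw [Finset.prod_insert hni, hupd, Function.update_self]
      rw [lintegral_const_mul _ ((hf i).mul_const _), lintegral_mul_const _ (hf i),
        Finset.prod_insert hi]
      ring
  rcases isEmpty_or_nonempty (ι → Y) with h | ⟨⟨x⟩⟩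
  · obtain ⟨i, hi⟩ : ∃ i : ι, IsEmpty Y := by
      by_contra! hcon
      exact h.false fun i => (hcon i).some
    rw [Finset.prod_eq_zero (Finset.mem_univ i)]
    · simp [Measure.eq_zero_of_isEmpty]
    · simp [Measure.eq_zero_of_isEmpty]
  · simpa using main Finset.univ x

theorem pi_withDensity {ι Y : Type*} [Fintype ι] [MeasurableSpace Y] (μ : Measure Y)
    [SigmaFinite μ] (f : ι → Y → ℝ≥0) (hf : ∀ i, Measurable (f i)) :
    Measure.pi (fun i => μ.withDensity fun y => (f i y : ℝ≥0∞)) =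
      (Measure.pi fun _ : ι => μ).withDensity fun y => ∏ i, (f i (y i) : ℝ≥0∞) := by
  refine Measure.pi_eq fun s hs => ?_
  rw [withDensity_apply _ (MeasurableSet.univ_pi hs), ← lintegral_indicator (.univ_pi hs)]
  have hind : ∀ y : ι → Y, (Set.univ.pi s).indicator (fun y => ∏ i, (f i (y i) : ℝ≥0∞)) y =
      ∏ i, (s i).indicator (fun t => (f i t : ℝ≥0∞)) (y i) := by
    intro y
    by_cases hy : ∀ i, y i ∈ s i
    · rw [indicator_of_mem (mem_univ_pi.2 hy)]
      exact Finset.prod_congr rfl fun i _ => by rw [indicator_of_mem (hy i)]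
    · rw [indicator_of_notMem (by simpa using hy)]
      push Not at hy
      obtain ⟨i, hi⟩ := hy
      exact (Finset.prod_eq_zero (Finset.mem_univ i) (indicator_of_notMem hi _)).symm
  simp_rw [hind]
  rw [lintegral_pi_prod (fun _ => μ) (fun i => (s i).indicator fun t => (f i t : ℝ≥0∞))
    fun i => (hf i).coe_nnreal_ennreal.indicator (hs i)]
  refine Finset.prod_congr rfl fun i _ => ?_
  rw [withDensity_apply _ (hs i), lintegral_indicator (hs i)]

theorem sqrt_prod {ι : Type*} (s : Finset ι) (f : ι → ℝ≥0) :
    NNReal.sqrt (∏ i ∈ s, f i) = ∏ i ∈ s, NNReal.sqrt (f i) := by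
  classical
  induction s using Finset.induction_on with
  | empty => simp
  | insert i s hi ih => rw [Finset.prod_insert hi, Finset.prod_insert hi, NNReal.sqrt_mul, ih]

/-- The squared Bhattacharyya coefficient of two densities is at most the product of the integrals of
their minimum and their maximum. -/
theorem lintegral_sqrt_mul_sq_le {Ω : Type*} [MeasurableSpace Ω] (μ : Measure Ω) {a b : Ω → ℝ≥0}
    (ha : Measurable a) (hb : Measurable b) :
    (∫⁻ y, (NNReal.sqrt (a y * b y) : ℝ≥0∞) ∂μ) ^ 2 ≤
      (∫⁻ y, (min (a y) (b y) : ℝ≥0) ∂μ) * ∫⁻ y, (max (a y) (b y) : ℝ≥0) ∂μ := by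
  have hsm : Measurable NNReal.sqrt := NNReal.continuous_sqrt.measurable
  -- Cauchy–Schwarz for √min and √max, whose product is √(ab).
  have h := ENNReal.lintegral_mul_le_Lp_mul_Lq μ (p := 2) (q := 2)
    (Real.holderConjugate_iff.2 ⟨by norm_num, by norm_num⟩)
    (f := fun y => (NNReal.sqrt (min (a y) (b y)) : ℝ≥0∞))
    (g := fun y => (NNReal.sqrt (max (a y) (b y)) : ℝ≥0∞))
    (hsm.comp (ha.min hb)).coe_nnreal_ennreal.aemeasurable
    (hsm.comp (ha.max hb)).coe_nnreal_ennreal.aemeasurable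
  have h1 : ∀ y, ((fun y => (NNReal.sqrt (min (a y) (b y)) : ℝ≥0∞)) *
      fun y => (NNReal.sqrt (max (a y) (b y)) : ℝ≥0∞)) y =
      (NNReal.sqrt (a y * b y) : ℝ≥0∞) := fun y => by
    rw [Pi.mul_apply, ← ENNReal.coe_mul, ← NNReal.sqrt_mul, min_mul_max]
  have h2 : ∀ c : ℝ≥0, (NNReal.sqrt c : ℝ≥0∞) ^ (2 : ℝ) = c := fun c => by
    rw [ENNReal.rpow_two, ← ENNReal.coe_pow, NNReal.sq_sqrt]
  simp_rw [h1, h2] at h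
  calc _ ≤ ((∫⁻ y, (min (a y) (b y) : ℝ≥0) ∂μ) ^ (1 / 2 : ℝ) *
        (∫⁻ y, (max (a y) (b y) : ℝ≥0) ∂μ) ^ (1 / 2 : ℝ)) ^ 2 := by gcongr
    _ = _ := by
      rw [mul_pow, ← ENNReal.rpow_mul_natCast, ← ENNReal.rpow_mul_natCast]
      norm_num

namespace BinaryChannel

variable {Y : Type u} [MeasurableSpace Y] (W : BinaryChannel Y)

/-- The likelihood ratio of the two inputs. -/
noncomputable def likelihoodRatio (y : Y) : ℝ≥0 := W.p 1 y / W.p 0 y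

theorem measurable_likelihoodRatio : Measurable W.likelihoodRatio :=
  (W.measurable_p 1).div (W.measurable_p 0)

instance isProbabilityMeasure_withDensity (x : ZMod 2) :
    IsProbabilityMeasure (W.ref.withDensity fun y => (W.p x y : ℝ≥0∞)) :=
  ⟨by rw [withDensity_apply _ MeasurableSet.univ, Measure.restrict_univ, W.lintegral_p]⟩

/-- The law of the likelihood ratio of the output, given the input `0`. -/
noncomputable def ratioLaw : Measure ℝ≥0 :=
  (W.ref.withDensity fun y => (W.p 0 y : ℝ≥0∞)).map W.likelihoodRatio

instance isProbabilityMeasure_ratioLaw : IsProbabilityMeasure W.ratioLaw :=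
  Measure.isProbabilityMeasure_map W.measurable_likelihoodRatio.aemeasurable

variable {ι : Type*} [Fintype ι]

theorem measurable_likelihood (c : ι → ZMod 2) : Measurable (W.likelihood c) :=
  Finset.measurable_fun_prod _ fun i _ => (W.measurable_p (c i)).comp (measurable_pi_apply i)

theorem outputLaw_eq_withDensity (c : ι → ZMod 2) :
    W.outputLaw c =
      (Measure.pi fun _ : ι => W.ref).withDensity fun y => (W.likelihood c y : ℝ≥0∞) := by
  rw [outputLaw, pi_withDensity _ _ fun i => W.measurable_p (c i)]
  simp [likelihood]

theorem lintegral_likelihood (c : ι → ZMod 2) :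
    ∫⁻ y, (W.likelihood c y : ℝ≥0∞) ∂(Measure.pi fun _ : ι => W.ref) = 1 := by
  simp only [likelihood, ENNReal.ofNNReal_finsetProd]
  rw [lintegral_pi_prod (fun _ => W.ref) (fun i y => (W.p (c i) y : ℝ≥0∞))
    fun i => (W.measurable_p _).coe_nnreal_ennreal]
  simp [W.lintegral_p]

instance isProbabilityMeasure_outputLaw (c : ι → ZMod 2) : IsProbabilityMeasure (W.outputLaw c) :=
  inferInstanceAs (IsProbabilityMeasure (Measure.pi _))

theorem measurable_sqrt_p_mul_p (a b : ZMod 2) :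
    Measurable fun y => (NNReal.sqrt (W.p a y * W.p b y) : ℝ≥0∞) :=
  (NNReal.continuous_sqrt.measurable.comp
    ((W.measurable_p a).mul (W.measurable_p b))).coe_nnreal_ennreal

theorem lintegral_sqrt_eq_bhattacharyya :
    ∫⁻ y, (NNReal.sqrt (W.p 0 y * W.p 1 y) : ℝ≥0∞) ∂W.ref = ENNReal.ofReal W.bhattacharyya := by
  have hle : ∫⁻ y, (NNReal.sqrt (W.p 0 y * W.p 1 y) : ℝ≥0∞) ∂W.ref ≤ 1 + 1 := by
    calc _ ≤ ∫⁻ y, ((W.p 0 y : ℝ≥0∞) + W.p 1 y) ∂W.ref := lintegral_mono fun y => by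
          rw [← ENNReal.coe_add, ENNReal.coe_le_coe, NNReal.sqrt_le_iff_le_sq]
          have h : (W.p 0 y + W.p 1 y) ^ 2 =
              W.p 0 y * W.p 1 y + (W.p 0 y ^ 2 + W.p 0 y * W.p 1 y + W.p 1 y ^ 2) := by ring
          rw [h]
          exact le_self_add
      _ = 1 + 1 := by
          rw [lintegral_add_left (W.measurable_p 0).coe_nnreal_ennreal, W.lintegral_p,
            W.lintegral_p]
  have hb : W.bhattacharyya =
      (∫⁻ y, (NNReal.sqrt (W.p 0 y * W.p 1 y) : ℝ≥0∞) ∂W.ref).toReal := by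
    rw [bhattacharyya, integral_eq_lintegral_of_nonneg_ae
      (Filter.Eventually.of_forall fun y => Real.sqrt_nonneg _)]
    · congr 1
      refine lintegral_congr fun y => ?_
      rw [← NNReal.coe_mul, ← Real.coe_sqrt, ENNReal.ofReal_coe_nnreal]
    · exact (((W.measurable_p 0).coe_nnreal_real.mul
        (W.measurable_p 1).coe_nnreal_real).sqrt).aestronglyMeasurable
  rw [hb, ENNReal.ofReal_toReal (ne_top_of_le_ne_top (by norm_num) hle)]

theorem bhattacharyya_nonneg : 0 ≤ W.bhattacharyya := integral_nonneg fun _ => Real.sqrt_nonneg _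

theorem lintegral_sqrt_likelihood (c : ι → ZMod 2) :
    ∫⁻ y, (NNReal.sqrt (W.likelihood 0 y * W.likelihood c y) : ℝ≥0∞)
      ∂(Measure.pi fun _ : ι => W.ref) = ENNReal.ofReal (W.bhattacharyya ^ hammingNorm c) := by
  have h : ∀ y : ι → Y, (NNReal.sqrt (W.likelihood 0 y * W.likelihood c y) : ℝ≥0∞) =
      ∏ i, (NNReal.sqrt (W.p 0 (y i) * W.p (c i) (y i)) : ℝ≥0∞) := by
    intro y
    rw [← ENNReal.ofNNReal_finsetProd, likelihood, likelihood, ← Finset.prod_mul_distrib,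
      sqrt_prod]
    rfl
  simp_rw [h]
  rw [lintegral_pi_prod (fun _ => W.ref)
    (fun i t => (NNReal.sqrt (W.p 0 t * W.p (c i) t) : ℝ≥0∞))
    fun i => W.measurable_sqrt_p_mul_p _ _]
  have hi : ∀ i, ∫⁻ t, (NNReal.sqrt (W.p 0 t * W.p (c i) t) : ℝ≥0∞) ∂W.ref =
      if c i ≠ 0 then ENNReal.ofReal W.bhattacharyya else 1 := by
    intro i
    have hc : c i = 0 ∨ c i = 1 := by
      generalize c i = z
      revert z; decide
    rcases hc with hc | hc
    · simp [hc, W.lintegral_p]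
    · simp [hc, W.lintegral_sqrt_eq_bhattacharyya]
  simp_rw [hi]
  rw [Finset.prod_ite, Finset.prod_const, Finset.prod_const_one, mul_one,
    ENNReal.ofReal_pow W.bhattacharyya_nonneg]
  rfl

end BinaryChannel

/-! ### Confusion events as increasing events of the likelihood ratios -/

theorem add_self_eq_zero_of_zmod_two {ι : Type*} (c : ι → ZMod 2) : c + c = 0 :=
  funext fun i => CharTwo.add_self_eq_zero (c i)

theorem zmod_two_eq_zero_or_one (a : ZMod 2) : a = 0 ∨ a = 1 := by revert a; decide

/-- The likelihood ratio vectors for which the codeword `c` is at least as likely as `0`. -/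
def confusionSet {ι : Type*} [Fintype ι] (c : ι → ZMod 2) : Set (ι → ℝ≥0) :=
  {z | 1 ≤ ∏ i with c i ≠ 0, z i}

theorem isUpperSet_confusionSet {ι : Type*} [Fintype ι] (c : ι → ZMod 2) :
    IsUpperSet (confusionSet c) := fun x y hxy hx => by
  rw [confusionSet, mem_ofPred_eq] at hx ⊢
  exact hx.trans (Finset.prod_le_prod' fun i _ => hxy i)

theorem measurableSet_confusionSet {ι : Type*} [Fintype ι] (c : ι → ZMod 2) :
    MeasurableSet (confusionSet c) :=
  measurableSet_le measurable_const
    (Finset.measurable_fun_prod _ fun i _ => measurable_pi_apply i)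

/-- At least `L` nonzero codewords are at least as likely as `0`. -/
def listErrorSet {ι : Type*} [Fintype ι] (C : Submodule (ZMod 2) (ι → ZMod 2)) (L : ℕ) :
    Set (ι → ℝ≥0) :=
  {z | L ≤ Set.ncard {c : ι → ZMod 2 | c ∈ C ∧ c ≠ 0 ∧ z ∈ confusionSet c}}

theorem mem_listErrorSet_iff {ι : Type*} [Fintype ι] (C : Submodule (ZMod 2) (ι → ZMod 2)) (L : ℕ)
    (z : ι → ℝ≥0) : z ∈ listErrorSet C L ↔
      ∃ S : Finset (ι → ZMod 2), S.card = L ∧ ∀ c ∈ S, c ∈ C ∧ c ≠ 0 ∧ z ∈ confusionSet c := by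
  classical
  constructor
  · intro h
    obtain ⟨S, hS, hcard⟩ := Set.exists_subset_card_eq h
    refine ⟨(Set.toFinite S).toFinset, ?_, fun c hc => hS (by simpa using hc)⟩
    rw [← hcard, Set.ncard_eq_toFinset_card S]
  · rintro ⟨S, rfl, hS⟩
    rw [listErrorSet, mem_ofPred_eq, ← Set.ncard_coe_finset]
    exact Set.ncard_le_ncard (fun c hc => hS c hc) (Set.toFinite _)

theorem measurableSet_listErrorSet {ι : Type*} [Fintype ι]
    (C : Submodule (ZMod 2) (ι → ZMod 2)) (L : ℕ) : MeasurableSet (listErrorSet C L) := by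
  classical
  have h : listErrorSet C L = ⋃ S ∈ {S : Finset (ι → ZMod 2) | S.card = L ∧
      ∀ c ∈ S, c ∈ C ∧ c ≠ 0}, ⋂ c ∈ S, confusionSet c := by
    ext z
    rw [mem_listErrorSet_iff]
    simp only [mem_iUnion, mem_iInter, mem_ofPred_eq, exists_prop]
    exact ⟨fun ⟨S, h1, h2⟩ => ⟨S, ⟨h1, fun c hc => ⟨(h2 c hc).1, (h2 c hc).2.1⟩⟩,
      fun c hc => (h2 c hc).2.2⟩, fun ⟨S, ⟨h1, h2⟩, h3⟩ => ⟨S, h1,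
        fun c hc => ⟨(h2 c hc).1, (h2 c hc).2, h3 c hc⟩⟩⟩
  rw [h]
  exact MeasurableSet.biUnion (Set.to_countable _) fun S _ =>
    Finset.measurableSet_biInter _ fun c _ => measurableSet_confusionSet c

theorem listErrorSet_anti {ι : Type*} [Fintype ι] (C : Submodule (ZMod 2) (ι → ZMod 2)) :
    Antitone (listErrorSet C) := fun _ _ h _ hz => h.trans hz

/-! ### Reduction to the zero codeword and pairwise error bounds -/

namespace BinaryChannel

variable {Y : Type u} [MeasurableSpace Y] (W : BinaryChannel Y) {ι : Type*} [Fintype ι]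

/-- This makes the value 0 that `likelihoodRatio` takes by default where `W.p 0` vanishes harmless:
such outputs have probability zero when 0 is sent. -/
theorem ae_p_zero_ne_zero :
    ∀ᵐ y ∂W.outputLaw (0 : ι → ZMod 2), ∀ i, W.p 0 (y i) ≠ 0 := by
  rw [Filter.eventually_all]
  intro i
  have h : ∀ᵐ t ∂(W.ref.withDensity fun y => (W.p 0 y : ℝ≥0∞)), W.p 0 t ≠ 0 := by
    rw [ae_withDensity_iff (W.measurable_p 0).coe_nnreal_ennreal]
    exact Filter.Eventually.of_forall fun t ht => by simpa using ht
  exact (Measure.quasiMeasurePreserving_eval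
    (fun _ : ι => W.ref.withDensity fun y => (W.p 0 y : ℝ≥0∞)) i).ae h

theorem likelihood_le_iff {y : ι → Y} (hy : ∀ i, W.p 0 (y i) ≠ 0) (c : ι → ZMod 2) :
    W.likelihood 0 y ≤ W.likelihood c y ↔ (fun i => W.likelihoodRatio (y i)) ∈ confusionSet c := by
  have h : W.likelihood c y =
      W.likelihood 0 y * ∏ i with c i ≠ 0, W.likelihoodRatio (y i) := by
    rw [likelihood, likelihood, Finset.prod_filter, ← Finset.prod_mul_distrib]
    refine Finset.prod_congr rfl fun i _ => ?_
    rcases zmod_two_eq_zero_or_one (c i) with hc | hc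
    · simp [hc]
    · simp [hc, likelihoodRatio, mul_div_cancel₀ _ (hy i)]
  have hpos : 0 < W.likelihood 0 y := Finset.prod_pos fun i _ => pos_iff_ne_zero.2 (hy i)
  rw [h, confusionSet, mem_ofPred_eq]
  exact le_mul_iff_one_le_right hpos

theorem map_outputLaw_zero : (W.outputLaw (0 : ι → ZMod 2)).map
    (fun y i => W.likelihoodRatio (y i)) = Measure.pi fun _ : ι => W.ratioLaw := by
  rw [outputLaw]
  exact Measure.pi_map_pi (hμ := fun _ => inferInstanceAs (SigmaFinite W.ratioLaw))
    fun _ => W.measurable_likelihoodRatio.aemeasurable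

theorem measurable_ratioVector {ι : Type*} : Measurable fun (y : ι → Y) i => W.likelihoodRatio (y i) :=
  measurable_pi_lambda _ fun i => W.measurable_likelihoodRatio.comp (measurable_pi_apply i)

theorem outputLaw_mapErrorEvent (C : Submodule (ZMod 2) (ι → ZMod 2)) (L : ℕ) :
    (W.outputLaw 0).real (W.mapErrorEvent C L 0) =
      (Measure.pi fun _ : ι => W.ratioLaw).real (listErrorSet C L) := by
  rw [← map_outputLaw_zero, map_measureReal_apply W.measurable_ratioVector
    (measurableSet_listErrorSet C L)]
  refine measureReal_congr ?_
  filter_upwards [W.ae_p_zero_ne_zero (ι := ι)] with y hy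
  refine propext ?_
  change L ≤ Set.ncard _ ↔ L ≤ Set.ncard _
  simp_rw [W.likelihood_le_iff hy]

theorem pi_confusionSet (c : ι → ZMod 2) :
    (Measure.pi fun _ : ι => W.ratioLaw) (confusionSet c) =
      W.outputLaw 0 {y | W.likelihood 0 y ≤ W.likelihood c y} := by
  rw [← map_outputLaw_zero, Measure.map_apply W.measurable_ratioVector
    (measurableSet_confusionSet c)]
  refine (measure_congr ?_).symm
  filter_upwards [W.ae_p_zero_ne_zero (ι := ι)] with y hy
  exact propext (W.likelihood_le_iff hy c)

theorem outputLaw_confusion (c : ι → ZMod 2) :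
    W.outputLaw 0 {y | W.likelihood 0 y ≤ W.likelihood c y} =
      ∫⁻ y in {y | W.likelihood 0 y ≤ W.likelihood c y}, W.likelihood 0 y
        ∂(Measure.pi fun _ : ι => W.ref) := by
  rw [outputLaw_eq_withDensity, withDensity_apply _
    (measurableSet_le (W.measurable_likelihood 0) (W.measurable_likelihood c))]

/-- Where a ≤ b one has a ≤ √(ab), and the integral of √(ab) over all outputs factorizes into one
factor Z for each position in the support of `c`. -/
theorem pi_confusionSet_le (c : ι → ZMod 2) :
    (Measure.pi fun _ : ι => W.ratioLaw).real (confusionSet c) ≤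
      W.bhattacharyya ^ hammingNorm c := by
  refine ENNReal.toReal_le_of_le_ofReal (pow_nonneg W.bhattacharyya_nonneg _) ?_
  rw [pi_confusionSet, outputLaw_confusion, ← lintegral_sqrt_likelihood]
  refine le_trans (setLIntegral_mono' (measurableSet_le (W.measurable_likelihood 0)
    (W.measurable_likelihood c)) fun y hy => ?_) (setLIntegral_le_lintegral _ _)
  rw [ENNReal.coe_le_coe, NNReal.le_sqrt_iff_sq_le, sq]
  exact mul_le_mul_right hy _

/-- `π` is a symmetry of the channel `W`. -/
structure IsSymmetry (W : BinaryChannel Y) (π : Y → Y) : Prop where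
  involutive : Function.Involutive π
  measurePreserving : MeasurePreserving π W.ref W.ref
  p_one : ∀ y, W.p 1 y = W.p 0 (π y)

open Classical in
/-- Apply the symmetry `π` in the positions where `c` is nonzero. -/
noncomputable def flip {ι : Type*} (π : Y → Y) (c : ι → ZMod 2) (y : ι → Y) : ι → Y :=
  fun i => if c i = 0 then y i else π (y i)

section Symmetric

variable {W} {π : Y → Y}

theorem IsSymmetry.measurePreserving_flip (h : W.IsSymmetry π) (c : ι → ZMod 2) :
    MeasurePreserving (flip π c) (Measure.pi fun _ : ι => W.ref) (Measure.pi fun _ => W.ref) := by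
  classical
  have := measurePreserving_pi (fun _ : ι => W.ref) (fun _ : ι => W.ref)
    (f := fun i t => if c i = 0 then t else π t) fun i => by
      by_cases hc : c i = 0
      · simp only [hc, if_true]
        exact MeasurePreserving.id _
      · simpa [hc] using h.measurePreserving
  convert this using 1
  funext y i
  simp only [flip]

theorem IsSymmetry.likelihood_flip (h : W.IsSymmetry π) (c c' : ι → ZMod 2) (y : ι → Y) :
    W.likelihood c' (flip π c y) = W.likelihood (c + c') y := by
  refine Finset.prod_congr rfl fun i _ => ?_
  have h0 : W.p 0 (y i) = W.p 1 (π (y i)) := by rw [h.p_one, h.involutive]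
  have h1 : W.p 0 (π (y i)) = W.p 1 (y i) := (h.p_one _).symm
  rcases zmod_two_eq_zero_or_one (c i) with hc | hc
  · simp [flip, hc]
  · rcases zmod_two_eq_zero_or_one (c' i) with hc' | hc'
    · simp [flip, hc, hc', h1]
    · simp [flip, hc, hc', ← h0, CharTwo.add_self_eq_zero]

theorem IsSymmetry.outputLaw_preimage_flip (h : W.IsSymmetry π) (c : ι → ZMod 2)
    {E : Set (ι → Y)} (hE : MeasurableSet E) :
    W.outputLaw 0 (flip π c ⁻¹' E) = W.outputLaw c E := by
  have hm := (h.measurePreserving_flip c).measurable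
  rw [outputLaw_eq_withDensity, outputLaw_eq_withDensity, withDensity_apply _ (hm hE),
    withDensity_apply _ hE, ← (h.measurePreserving_flip c).setLIntegral_comp_preimage hE
      (W.measurable_likelihood c).coe_nnreal_ennreal]
  simp_rw [h.likelihood_flip, add_self_eq_zero_of_zmod_two]

/-- Flipping the output along `c` translates all likelihoods by `c`, and c' ↦ c + c' is a bijection
from the nonzero codewords to the codewords other than `c`. -/
theorem IsSymmetry.preimage_flip_mapErrorEvent (h : W.IsSymmetry π)
    (C : Submodule (ZMod 2) (ι → ZMod 2)) (L : ℕ) {c : ι → ZMod 2} (hc : c ∈ C) :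
    flip π c ⁻¹' W.mapErrorEvent C L c = W.mapErrorEvent C L 0 := by
  ext y
  change L ≤ Set.ncard _ ↔ L ≤ Set.ncard _
  simp_rw [h.likelihood_flip, add_self_eq_zero_of_zmod_two]
  rw [← Set.ncard_image_of_injective {c' | c' ∈ C ∧ c' ≠ 0 ∧ _} (add_right_injective c)]
  have hcc : c + c = 0 := add_self_eq_zero_of_zmod_two c
  have hset : (fun x => c + x) '' {c' | c' ∈ C ∧ c' ≠ 0 ∧ W.likelihood 0 y ≤ W.likelihood c' y} =
      {c' | c' ∈ C ∧ c' ≠ c ∧ W.likelihood 0 y ≤ W.likelihood (c + c') y} := by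
    ext x
    simp only [mem_image, mem_ofPred_eq]
    constructor
    · rintro ⟨c', ⟨h1, h2, h3⟩, rfl⟩
      refine ⟨C.add_mem hc h1, by simpa using h2, ?_⟩
      rwa [← add_assoc, hcc, zero_add]
    · rintro ⟨h1, h2, h3⟩
      refine ⟨c + x, ⟨C.add_mem hc h1, fun h0 => h2 ?_, h3⟩, by rw [← add_assoc, hcc, zero_add]⟩
      rw [← add_right_injective c |>.eq_iff, hcc]
      exact h0
  rw [hset]

theorem measurableSet_mapErrorEvent (W : BinaryChannel Y) (C : Submodule (ZMod 2) (ι → ZMod 2))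
    (L : ℕ) (c : ι → ZMod 2) : MeasurableSet (W.mapErrorEvent C L c) := by
  classical
  have h : W.mapErrorEvent C L c = {y | L ≤ ∑ c' : ι → ZMod 2,
      {y | c' ∈ C ∧ c' ≠ c ∧ W.likelihood c y ≤ W.likelihood c' y}.indicator (fun _ => 1) y} := by
    ext y
    rw [mapErrorEvent, mem_ofPred_eq, mem_ofPred_eq, Set.ncard_eq_toFinset_card', Set.toFinset_ofPred,
      Finset.card_filter]
    simp [indicator]
  rw [h]
  refine measurableSet_le measurable_const (Finset.measurable_fun_sum _ fun c' _ =>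
    measurable_const.indicator ?_)
  by_cases h1 : c' ∈ C ∧ c' ≠ c
  · simpa [h1.1, h1.2] using
      measurableSet_le (W.measurable_likelihood c) (W.measurable_likelihood c')
  · convert MeasurableSet.empty
    ext y
    simp only [mem_ofPred_eq, mem_empty_iff_false, iff_false]
    exact fun h => h1 ⟨h.1, h.2.1⟩

/-- By symmetry, the block error probability is the one given that the zero codeword is sent. -/
theorem IsSymmetry.mapErrorProb_eq (h : W.IsSymmetry π) (C : Submodule (ZMod 2) (ι → ZMod 2))
    (L : ℕ) : W.mapErrorProb C L =
      (Measure.pi fun _ : ι => W.ratioLaw).real (listErrorSet C L) := by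
  classical
  have hc : ∀ c ∈ C, (W.outputLaw c).real (W.mapErrorEvent C L c) =
      (Measure.pi fun _ : ι => W.ratioLaw).real (listErrorSet C L) := by
    intro c hc
    rw [← outputLaw_mapErrorEvent, measureReal_def, measureReal_def,
      ← h.outputLaw_preimage_flip c (W.measurableSet_mapErrorEvent C L c),
      h.preimage_flip_mapErrorEvent C L hc]
  rw [mapErrorProb, Finset.sum_congr rfl fun c hc' => hc c (by simpa using hc'), Finset.sum_const,
    nsmul_eq_mul]
  have hcard : (Finset.univ.filter fun c => c ∈ C).card = Nat.card C := by
    rw [Nat.card_eq_fintype_card, Fintype.card_subtype]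
  have hne : (Nat.card C : ℝ) ≠ 0 := by exact_mod_cast Nat.card_pos.ne'
  convert mul_div_cancel_left₀ _ hne using 3
  exact_mod_cast hcard

/-- A converse to the Bhattacharyya bound. With a, b the likelihoods of 0 and `c`, (∫√(ab))² ≤
∫min(a,b) · ∫max(a,b). The second factor is at most 2; the first is at most twice the confusion
probability, since the symmetry exchanges the roles of a and b. -/
theorem IsSymmetry.le_pi_confusionSet (h : W.IsSymmetry π) (c : ι → ZMod 2) :
    (W.bhattacharyya ^ hammingNorm c) ^ 2 / 4 ≤
      (Measure.pi fun _ : ι => W.ratioLaw).real (confusionSet c) := by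
  set m := Measure.pi fun _ : ι => W.ref with hm
  have hA := W.measurable_likelihood (0 : ι → ZMod 2)
  have hB := W.measurable_likelihood c
  have hS : MeasurableSet {y | W.likelihood 0 y ≤ W.likelihood c y} := measurableSet_le hA hB
  have hcs := lintegral_sqrt_mul_sq_le m hA hB
  have hmax : ∫⁻ y, (max (W.likelihood 0 y) (W.likelihood c y) : ℝ≥0) ∂m ≤ 2 := by
    calc _ ≤ ∫⁻ y, ((W.likelihood 0 y : ℝ≥0∞) + W.likelihood c y) ∂m := lintegral_mono fun y => by
          rw [← ENNReal.coe_add, ENNReal.coe_le_coe]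
          exact max_le_add_of_nonneg zero_le zero_le
      _ = 2 := by
          rw [lintegral_add_left hA.coe_nnreal_ennreal, lintegral_likelihood, lintegral_likelihood,
            one_add_one_eq_two]
  have hflip : ∫⁻ y in {y | W.likelihood c y ≤ W.likelihood 0 y}, W.likelihood c y ∂m =
      ∫⁻ y in {y | W.likelihood 0 y ≤ W.likelihood c y}, W.likelihood 0 y ∂m := by
    rw [← (h.measurePreserving_flip c).setLIntegral_comp_preimage (measurableSet_le hB hA)
      hB.coe_nnreal_ennreal]
    simp_rw [preimage_ofPred_eq, h.likelihood_flip, add_self_eq_zero_of_zmod_two, add_zero]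
    rfl
  have hmin : ∫⁻ y, (min (W.likelihood 0 y) (W.likelihood c y) : ℝ≥0) ∂m ≤
      2 * ∫⁻ y in {y | W.likelihood 0 y ≤ W.likelihood c y}, W.likelihood 0 y ∂m := by
    rw [← lintegral_add_compl _ hS, two_mul]
    refine add_le_add (setLIntegral_mono' hS fun y _ => by exact_mod_cast min_le_left _ _) ?_
    rw [← hflip]
    refine (lintegral_mono (g := fun y => (W.likelihood c y : ℝ≥0∞)) fun y => ?_).trans
      (lintegral_mono_set fun y hy => ?_)
    · exact ENNReal.coe_le_coe.2 (min_le_right _ _)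
    · change W.likelihood c y ≤ W.likelihood 0 y
      exact le_of_not_ge (show ¬ W.likelihood 0 y ≤ W.likelihood c y from hy)
  rw [lintegral_sqrt_likelihood, ← outputLaw_confusion, ← pi_confusionSet] at *
  have hfin : ENNReal.ofReal (W.bhattacharyya ^ hammingNorm c) ^ 2 ≤
      2 * (Measure.pi fun _ : ι => W.ratioLaw) (confusionSet c) * 2 :=
    hcs.trans (mul_le_mul' hmin hmax)
  have := ENNReal.toReal_mono (by finiteness) hfin
  rw [ENNReal.toReal_pow, ENNReal.toReal_ofReal (pow_nonneg W.bhattacharyya_nonneg _),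
    ENNReal.toReal_mul, ENNReal.toReal_mul, ENNReal.toReal_ofNat] at this
  rw [measureReal_def]
  linarith

end Symmetric

end BinaryChannel

/-! ### Divide and intersect for list decoding -/

theorem pow_two_pow_le_of_sq_le {a : ℕ → ℝ} (ha : ∀ m, 0 ≤ a m) (k : ℕ)
    (h : ∀ m < k, 3 / 16 * a m ^ 2 ≤ a (m + 1)) :
    (3 / 16 : ℝ) ^ (2 ^ k - 1) * a 0 ^ (2 ^ k) ≤ a k := by
  induction k with
  | zero => simp
  | succ k ih =>
    have h1 := ih fun m hm => h m (by omega)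
    have h2 : (2 : ℕ) ^ (k + 1) - 1 = 1 + (2 ^ k - 1) * 2 := by
      have := Nat.one_le_two_pow (n := k)
      rw [pow_succ]; omega
    calc (3 / 16 : ℝ) ^ (2 ^ (k + 1) - 1) * a 0 ^ (2 ^ (k + 1))
        = 3 / 16 * ((3 / 16 : ℝ) ^ (2 ^ k - 1) * a 0 ^ (2 ^ k)) ^ 2 := by
          rw [h2, pow_add, pow_mul, mul_pow, pow_succ 2 k, pow_mul (a 0)]; ring
      _ ≤ 3 / 16 * a k ^ 2 := by
          gcongr
          exact mul_nonneg (by positivity) (pow_nonneg (ha 0) _)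
      _ ≤ a (k + 1) := h k (by omega)

section DivideAndIntersect

variable {ι : Type*} [Fintype ι] (μ : Measure ℝ≥0) [IsProbabilityMeasure μ]
  (C : Submodule (ZMod 2) (ι → ZMod 2))

/-- Divide and intersect for the events that all codewords of an `m`-set beat 0. As m ≥ 1, each lies
in the confusion event of a single codeword and so inherits its smallness. -/
theorem listErrorSet_succ_ge {m : ℕ} (hm : 1 ≤ m)
    (hsmall : ∀ c ∈ C, c ≠ 0 → (Measure.pi fun _ : ι => μ).real (confusionSet c) ≤
      (Measure.pi fun _ : ι => μ).real (listErrorSet C m) / 8) :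
    3 / 16 * (Measure.pi fun _ : ι => μ).real (listErrorSet C m) ^ 2 ≤
      (Measure.pi fun _ : ι => μ).real (listErrorSet C (m + 1)) := by
  classical
  set T := (Finset.univ.filter fun c => c ∈ C ∧ c ≠ 0).powersetCard m with hT
  have hTmem : ∀ S, S ∈ T ↔ S.card = m ∧ ∀ c ∈ S, c ∈ C ∧ c ≠ 0 := by
    intro S
    rw [hT, Finset.mem_powersetCard, and_comm]
    refine and_congr Iff.rfl ⟨fun h c hc => by simpa using h hc, fun h c hc => ?_⟩
    simpa using h c hc
  have hU : (⋃ S ∈ T, ⋂ c ∈ S, confusionSet c) = listErrorSet C m := by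
    ext z
    rw [mem_listErrorSet_iff]
    simp only [mem_iUnion, mem_iInter, exists_prop, hTmem]
    exact ⟨fun ⟨S, ⟨h1, h2⟩, h3⟩ => ⟨S, h1, fun c hc => ⟨(h2 c hc).1, (h2 c hc).2, h3 c hc⟩⟩,
      fun ⟨S, h1, h2⟩ => ⟨S, ⟨h1, fun c hc => ⟨(h2 c hc).1, (h2 c hc).2.1⟩⟩,
        fun c hc => (h2 c hc).2.2⟩⟩
  have key := divide_and_intersect (fun _ : ι => μ) T (fun S => ⋂ c ∈ S, confusionSet c)
    (fun S _ => isUpperSet_iInter₂ fun c _ => isUpperSet_confusionSet c)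
    (fun S _ => Finset.measurableSet_biInter _ fun c _ => measurableSet_confusionSet c)
    (F := listErrorSet C (m + 1)) ?_ ?_
  · rwa [hU] at key
  · intro S hS
    obtain ⟨h1, h2⟩ := (hTmem S).1 hS
    obtain ⟨c, hc⟩ : S.Nonempty := Finset.card_pos.1 (by omega)
    rw [hU]
    exact (measureReal_mono (biInter_subset_of_mem (Finset.mem_coe.2 hc))).trans
      (hsmall c (h2 c hc).1 (h2 c hc).2)
  · rintro S hS S' hS' hne z ⟨hz, hz'⟩
    obtain ⟨h1, h2⟩ := (hTmem S).1 hS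
    obtain ⟨h1', h2'⟩ := (hTmem S').1 hS'
    simp only [mem_iInter] at hz hz'
    -- Different sets of equal size are not nested, so the union has at least m + 1 elements.
    obtain ⟨c, hc, hcS⟩ : ∃ c ∈ S', c ∉ S := by
      by_contra! hcon
      exact hne (Finset.eq_of_subset_of_card_le hcon (by omega)).symm
    rw [mem_listErrorSet_iff]
    refine ⟨insert c S, by rw [Finset.card_insert_of_notMem hcS, h1], fun e he => ?_⟩
    rcases Finset.mem_insert.1 he with rfl | he
    · exact ⟨(h2' e hc).1, (h2' e hc).2, hz' e hc⟩
    · exact ⟨(h2 e he).1, (h2 e he).2, hz e he⟩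

/-- The single threshold P serves all steps, because the failure probability decreases with the list
size and still exceeds P at size L. The L steps lead from list size 1 to L + 1. -/
theorem listErrorSet_iterate {L : ℕ} {P : ℝ}
    (hP : P < (Measure.pi fun _ : ι => μ).real (listErrorSet C L))
    (hsmall : ∀ c ∈ C, c ≠ 0 → (Measure.pi fun _ : ι => μ).real (confusionSet c) ≤ P / 8) :
    (3 / 16 : ℝ) ^ (2 ^ L - 1) *
      (Measure.pi fun _ : ι => μ).real (listErrorSet C 1) ^ (2 ^ L) ≤
      (Measure.pi fun _ : ι => μ).real (listErrorSet C (L + 1)) := by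
  refine pow_two_pow_le_of_sq_le
    (a := fun m => (Measure.pi fun _ : ι => μ).real (listErrorSet C (m + 1)))
    (fun m => measureReal_nonneg) L fun m hm =>
      listErrorSet_succ_ge μ C (by omega) fun c hc hc0 => (hsmall c hc hc0).trans ?_
  have := measureReal_mono (μ := Measure.pi fun _ : ι => μ)
    (listErrorSet_anti C (show m + 1 ≤ L by omega))
  linarith

end DivideAndIntersect

/-! ### Doubling the list size over the erasure channel -/

section Erasure

variable {ι : Type*} [Fintype ι]

theorem mem_confusionSet_iff_of_zero_or_one {z : ι → ℝ≥0} (hz : ∀ i, z i = 0 ∨ z i = 1)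
    (c : ι → ZMod 2) : z ∈ confusionSet c ↔ ∀ i, c i ≠ 0 → z i = 1 := by
  rw [confusionSet, mem_ofPred_eq]
  constructor
  · intro h i hi
    refine (hz i).resolve_left fun h0 => ?_
    rw [Finset.prod_eq_zero (Finset.mem_filter.2 ⟨Finset.mem_univ i, hi⟩) h0] at h
    exact absurd h (by norm_num)
  · intro h
    rw [Finset.prod_eq_one fun i hi => h i (Finset.mem_filter.1 hi).2]

/-- The codewords that are compatible with the erased positions `{i | z i = 1}`. -/
def compatibleCode (C : Submodule (ZMod 2) (ι → ZMod 2)) (z : ι → ℝ≥0) :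
    Submodule (ZMod 2) (ι → ZMod 2) where
  carrier := {c | c ∈ C ∧ ∀ i, c i ≠ 0 → z i = 1}
  add_mem' {a b} ha hb := ⟨C.add_mem ha.1 hb.1, fun i hi => by
    by_cases h : a i = 0
    · exact hb.2 i (by simpa [h] using hi)
    · exact ha.2 i h⟩
  zero_mem' := ⟨C.zero_mem, fun i hi => absurd rfl hi⟩
  smul_mem' r a ha := ⟨C.smul_mem r ha.1, fun i hi => ha.2 i fun h => hi (by simp [h])⟩

theorem natCard_submodule (V : Submodule (ZMod 2) (ι → ZMod 2)) :
    Nat.card V = 2 ^ Module.finrank (ZMod 2) V := by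
  rw [Module.natCard_eq_pow_finrank (K := ZMod 2)]
  simp

theorem ncard_nonzero (V : Submodule (ZMod 2) (ι → ZMod 2)) :
    Set.ncard {c | c ∈ V ∧ c ≠ 0} + 1 = 2 ^ Module.finrank (ZMod 2) V := by
  rw [← natCard_submodule]
  have h : {c | c ∈ V ∧ c ≠ 0} = (V : Set (ι → ZMod 2)) \ {0} := by ext; simp
  rw [h, Set.ncard_sdiff_singleton_add_one V.zero_mem (Set.toFinite _)]
  rfl

/-- The number of nonzero compatible codewords is 2^k − 1, with k the dimension, and 2^l ≤ 2^k − 1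
exactly when l < k. -/
theorem mem_listErrorSet_two_pow_iff (C : Submodule (ZMod 2) (ι → ZMod 2)) {z : ι → ℝ≥0}
    (hz : ∀ i, z i = 0 ∨ z i = 1) (l : ℕ) :
    z ∈ listErrorSet C (2 ^ l) ↔ l + 1 ≤ Module.finrank (ZMod 2) (compatibleCode C z) := by
  have h : {c : ι → ZMod 2 | c ∈ C ∧ c ≠ 0 ∧ z ∈ confusionSet c} =
      {c | c ∈ compatibleCode C z ∧ c ≠ 0} := by
    ext c
    simp only [mem_ofPred_eq, mem_confusionSet_iff_of_zero_or_one hz]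
    exact ⟨fun ⟨h1, h2, h3⟩ => ⟨⟨h1, h3⟩, h2⟩, fun ⟨⟨h1, h3⟩, h2⟩ => ⟨h1, h2, h3⟩⟩
  rw [listErrorSet, mem_ofPred_eq, h]
  have h1 := ncard_nonzero (compatibleCode C z)
  constructor
  · intro hle
    refine (Nat.pow_lt_pow_iff_right (a := 2) one_lt_two).1 ?_
    omega
  · intro hle
    have h2 : 2 ^ (l + 1) ≤ 2 ^ Module.finrank (ZMod 2) (compatibleCode C z) :=
      Nat.pow_le_pow_right two_pos hle
    have h3 := Nat.one_le_two_pow (n := l)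
    rw [pow_succ] at h2
    omega

theorem exists_submodule_le_finrank_eq {ι : Type*} [Finite ι]
    (K : Submodule (ZMod 2) (ι → ZMod 2)) {k : ℕ}
    (hk : k ≤ Module.finrank (ZMod 2) K) :
    ∃ V ≤ K, Module.finrank (ZMod 2) V = k := by
  obtain ⟨v, hv⟩ := exists_linearIndependent_of_le_finrank hk
  have hw := hv.map' K.subtype K.ker_subtype
  refine ⟨Submodule.span (ZMod 2) (Set.range (K.subtype ∘ v)), ?_, ?_⟩
  · rw [Submodule.span_le]
    rintro _ ⟨i, rfl⟩
    exact (v i).2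
  · rw [finrank_span_eq_card hw, Fintype.card_fin]

variable (μ : Measure ℝ≥0) [IsProbabilityMeasure μ] (C : Submodule (ZMod 2) (ι → ZMod 2))

theorem listErrorSet_two_mul_ge (hμ : ∀ᵐ r ∂μ, r = 0 ∨ r = 1) (l : ℕ)
    (hsmall : ∀ c ∈ C, c ≠ 0 → (Measure.pi fun _ : ι => μ).real (confusionSet c) ≤
      (Measure.pi fun _ : ι => μ).real (listErrorSet C (2 ^ l)) / 8) :
    3 / 16 * (Measure.pi fun _ : ι => μ).real (listErrorSet C (2 ^ l)) ^ 2 ≤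
      (Measure.pi fun _ : ι => μ).real (listErrorSet C (2 ^ (l + 1))) := by
  classical
  have hae : ∀ᵐ z ∂(Measure.pi fun _ : ι => μ), ∀ i, z i = 0 ∨ z i = 1 := by
    rw [Filter.eventually_all]
    exact fun i => (Measure.quasiMeasurePreserving_eval (fun _ : ι => μ) i).ae hμ
  set T : Finset (Submodule (ZMod 2) (ι → ZMod 2)) :=
    (Set.toFinite {V | V ≤ C ∧ Module.finrank (ZMod 2) V = l + 1}).toFinset with hT
  have hTmem : ∀ V, V ∈ T ↔ V ≤ C ∧ Module.finrank (ZMod 2) V = l + 1 := by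
    intro V; simp [hT]
  let E : Submodule (ZMod 2) (ι → ZMod 2) → Set (ι → ℝ≥0) :=
    fun V => ⋂ c ∈ Finset.univ.filter (· ∈ V), confusionSet c
  have hmemE : ∀ V ≤ C, ∀ z : ι → ℝ≥0, (∀ i, z i = 0 ∨ z i = 1) →
      (z ∈ E V ↔ V ≤ compatibleCode C z) := by
    intro V hV z hz
    simp only [E, mem_iInter, Finset.mem_filter, Finset.mem_univ, true_and,
      mem_confusionSet_iff_of_zero_or_one hz]
    exact ⟨fun h c hc => ⟨hV hc, h c hc⟩, fun h c hc => (h hc).2⟩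
  have hU : (Measure.pi fun _ : ι => μ).real (⋃ V ∈ T, E V) =
      (Measure.pi fun _ : ι => μ).real (listErrorSet C (2 ^ l)) := by
    refine measureReal_congr ?_
    filter_upwards [hae] with z hz
    refine propext ?_
    change z ∈ ⋃ V ∈ T, E V ↔ z ∈ listErrorSet C (2 ^ l)
    rw [mem_listErrorSet_two_pow_iff C hz]
    simp only [mem_iUnion, exists_prop, hTmem]
    constructor
    · rintro ⟨V, ⟨hV, hVd⟩, hzV⟩
      rw [← hVd]
      exact Submodule.finrank_mono ((hmemE V hV z hz).1 hzV)
    · intro hle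
      obtain ⟨V, hV, hVd⟩ := exists_submodule_le_finrank_eq _ hle
      have hVC : V ≤ C := hV.trans fun c hc => hc.1
      exact ⟨V, ⟨hVC, hVd⟩, (hmemE V hVC z hz).2 hV⟩
  -- The inclusion of pairwise intersections holds only for ratios in {0, 1}; enlarging the target
  -- by a null set makes it hold everywhere.
  have hF : (Measure.pi fun _ : ι => μ).real
      {z | (∀ i, z i = 0 ∨ z i = 1) → z ∈ listErrorSet C (2 ^ (l + 1))} =
      (Measure.pi fun _ : ι => μ).real (listErrorSet C (2 ^ (l + 1))) := by
    refine measureReal_congr ?_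
    filter_upwards [hae] with z hz
    exact propext ⟨fun h => h hz, fun h _ => h⟩
  have key := divide_and_intersect (fun _ : ι => μ) T E
    (fun V _ => isUpperSet_iInter₂ fun c _ => isUpperSet_confusionSet c)
    (fun V _ => Finset.measurableSet_biInter _ fun c _ => measurableSet_confusionSet c)
    (F := {z | (∀ i, z i = 0 ∨ z i = 1) → z ∈ listErrorSet C (2 ^ (l + 1))}) ?_ ?_
  · rwa [hU, hF] at key
  · intro V hV
    obtain ⟨hVC, hVd⟩ := (hTmem V).1 hV
    have hne : V ≠ ⊥ := by
      rintro rfl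
      simp at hVd
    obtain ⟨c, hc, hc0⟩ := V.exists_mem_ne_zero_of_ne_bot hne
    rw [hU]
    refine (measureReal_mono ?_).trans (hsmall c (hVC hc) hc0)
    exact biInter_subset_of_mem (by simpa using hc)
  · rintro V hV V' hV' hne z ⟨hzV, hzV'⟩ hz
    obtain ⟨hVC, hVd⟩ := (hTmem V).1 hV
    obtain ⟨hVC', hVd'⟩ := (hTmem V').1 hV'
    have h1 := (hmemE V hVC z hz).1 hzV
    have h2 := (hmemE V' hVC' z hz).1 hzV'
    rw [mem_listErrorSet_two_pow_iff C hz]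
    -- Two different compatible subspaces of dimension l + 1 span one of dimension at least l + 2,
    -- which is failure at list size 2^(l+1).
    have hlt : V < V ⊔ V' := lt_of_le_of_ne le_sup_left fun h => hne <| by
      have hle : V' ≤ V := by rw [h]; exact le_sup_right
      exact (Submodule.eq_of_le_of_finrank_eq hle (by omega)).symm
    have h3 := Submodule.finrank_lt_finrank_of_lt hlt
    have h4 := Submodule.finrank_mono (sup_le h1 h2)
    omega

theorem listErrorSet_two_pow_iterate (hμ : ∀ᵐ r ∂μ, r = 0 ∨ r = 1) {l : ℕ} {P : ℝ}
    (hP : P < (Measure.pi fun _ : ι => μ).real (listErrorSet C (2 ^ l)))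
    (hsmall : ∀ c ∈ C, c ≠ 0 → (Measure.pi fun _ : ι => μ).real (confusionSet c) ≤ P / 8) :
    (3 / 16 : ℝ) ^ (2 ^ (l + 1) - 1) *
      (Measure.pi fun _ : ι => μ).real (listErrorSet C 1) ^ (2 ^ (l + 1)) ≤
      (Measure.pi fun _ : ι => μ).real (listErrorSet C (2 ^ (l + 1))) := by
  have key := pow_two_pow_le_of_sq_le
    (a := fun m => (Measure.pi fun _ : ι => μ).real (listErrorSet C (2 ^ m)))
    (fun m => measureReal_nonneg) (l + 1) fun m hm =>
      listErrorSet_two_mul_ge μ C hμ m fun c hc hc0 => (hsmall c hc hc0).trans ?_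
  · simpa using key
  have := measureReal_mono (μ := Measure.pi fun _ : ι => μ)
    (listErrorSet_anti C (Nat.pow_le_pow_right two_pos (show m ≤ l by omega)))
  linarith

end Erasure

/-! ### Bhattacharyya parameters under the polar transforms -/

theorem pow_le_of_log_div_log_lt {Z x : ℝ} (hZ : Z ∈ Ioo (0 : ℝ) 1) (hx : 0 < x) {k : ℕ}
    (hk : Real.log x / Real.log Z < k) : Z ^ k ≤ x := by
  rw [div_lt_iff_of_neg (Real.log_neg hZ.1 hZ.2)] at hk
  rw [← Real.log_le_log_iff (pow_pos hZ.1 _) hx, Real.log_pow]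
  exact hk.le

theorem minDistance_le_hammingNorm {ι : Type*} [Fintype ι] {C : Submodule (ZMod 2) (ι → ZMod 2)}
    {c : ι → ZMod 2} (hc : c ∈ C) (hc0 : c ≠ 0) : minDistance C ≤ hammingNorm c :=
  Nat.sInf_le ⟨c, hc, hc0, rfl⟩

/-- The norm of an integral is at most the integral of the norm, for the weighted Euclidean norm of
(s, g). The proof integrates the pointwise Cauchy–Schwarz inequality against the mean vector (1, Z).
-/
theorem sqrt_le_integral_sqrt {Ω : Type*} [MeasurableSpace Ω] {μ : Measure Ω} {s g : Ω → ℝ}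
    (hs : Integrable s μ) (hg : Integrable g μ) (hs0 : ∀ y, 0 ≤ s y) (hg0 : ∀ y, 0 ≤ g y)
    (hs1 : ∫ y, s y ∂μ = 1) {Z : ℝ} (hgZ : ∫ y, g y ∂μ = Z) {a b : ℝ} (ha : 0 ≤ a) (hb : 0 ≤ b) :
    Integrable (fun y => √(a * s y ^ 2 + b * g y ^ 2)) μ ∧
      √(a + b * Z ^ 2) ≤ ∫ y, √(a * s y ^ 2 + b * g y ^ 2) ∂μ := by
  have hint : Integrable (fun y => √(a * s y ^ 2 + b * g y ^ 2)) μ := by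
    refine ((hs.const_mul (√a)).add (hg.const_mul (√b))).mono' ?_ ?_
    · exact Real.continuous_sqrt.comp_aestronglyMeasurable
        (((hs.1.pow 2).const_mul a).add ((hg.1.pow 2).const_mul b))
    · refine Filter.Eventually.of_forall fun y => ?_
      have h1 : 0 ≤ √a * s y := mul_nonneg (Real.sqrt_nonneg _) (hs0 y)
      have h2 : 0 ≤ √b * g y := mul_nonneg (Real.sqrt_nonneg _) (hg0 y)
      rw [Real.norm_of_nonneg (Real.sqrt_nonneg _), Pi.add_apply]
      refine Real.sqrt_le_iff.2 ⟨add_nonneg h1 h2, ?_⟩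
      have e1 : (√a * s y) ^ 2 = a * s y ^ 2 := by rw [mul_pow, Real.sq_sqrt ha]
      have e2 : (√b * g y) ^ 2 = b * g y ^ 2 := by rw [mul_pow, Real.sq_sqrt hb]
      nlinarith [mul_nonneg h1 h2]
  refine ⟨hint, ?_⟩
  have hκ0 : 0 ≤ a + b * Z ^ 2 := by positivity
  rcases (Real.sqrt_nonneg (a + b * Z ^ 2)).eq_or_lt with h0 | hpos
  · rw [← h0]; exact integral_nonneg fun _ => Real.sqrt_nonneg _
  have hle : ∫ y, (a * s y + b * Z * g y) ∂μ ≤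
      ∫ y, √(a + b * Z ^ 2) * √(a * s y ^ 2 + b * g y ^ 2) ∂μ := by
    refine integral_mono ((hs.const_mul a).add (hg.const_mul (b * Z))) (hint.const_mul _)
      fun y => ?_
    change a * s y + b * Z * g y ≤ √(a + b * Z ^ 2) * √(a * s y ^ 2 + b * g y ^ 2)
    rw [← Real.sqrt_mul hκ0]
    refine Real.le_sqrt_of_sq_le ?_
    have : 0 ≤ a * b * (g y - Z * s y) ^ 2 := by positivity
    nlinarith
  rw [integral_const_mul, integral_add (hs.const_mul a) (hg.const_mul (b * Z)),
    integral_const_mul, integral_const_mul, hs1, hgZ] at hle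
  have hsq := Real.mul_self_sqrt hκ0
  refine le_of_mul_le_mul_left ?_ hpos
  linarith [hle, hsq]

namespace BinaryChannel

variable {Y : Type u} [MeasurableSpace Y] (W : BinaryChannel Y)

theorem integrable_p (x : ZMod 2) : Integrable (fun y => (W.p x y : ℝ)) W.ref := by
  refine ⟨(W.measurable_p x).coe_nnreal_real.aestronglyMeasurable, ?_⟩
  rw [hasFiniteIntegral_iff_ofReal (Filter.Eventually.of_forall fun y => NNReal.coe_nonneg _)]
  simp [W.lintegral_p]

theorem integral_p (x : ZMod 2) : ∫ y, (W.p x y : ℝ) ∂W.ref = 1 := by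
  rw [integral_eq_lintegral_of_nonneg_ae (Filter.Eventually.of_forall fun y => NNReal.coe_nonneg _)
    (W.measurable_p x).coe_nnreal_real.aestronglyMeasurable]
  simp [W.lintegral_p]

/-- The geometric mean of the two transition densities. -/
noncomputable def geomMean (y : Y) : ℝ := √((W.p 0 y : ℝ) * (W.p 1 y : ℝ))

/-- The arithmetic mean of the two transition densities. -/
noncomputable def arithMean (y : Y) : ℝ := ((W.p 0 y : ℝ) + (W.p 1 y : ℝ)) / 2

theorem geomMean_nonneg (y : Y) : 0 ≤ W.geomMean y := Real.sqrt_nonneg _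

theorem geomMean_sq (y : Y) : W.geomMean y ^ 2 = (W.p 0 y : ℝ) * (W.p 1 y : ℝ) :=
  Real.sq_sqrt (by positivity)

theorem geomMean_le_arithMean (y : Y) : W.geomMean y ≤ W.arithMean y := by
  refine Real.sqrt_le_iff.2 ⟨by unfold arithMean; positivity, ?_⟩
  unfold arithMean
  nlinarith [sq_nonneg ((W.p 0 y : ℝ) - W.p 1 y)]

theorem arithMean_nonneg (y : Y) : 0 ≤ W.arithMean y :=
  (W.geomMean_nonneg y).trans (W.geomMean_le_arithMean y)

theorem integrable_arithMean : Integrable W.arithMean W.ref :=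
  ((W.integrable_p 0).add (W.integrable_p 1)).div_const 2

theorem integral_arithMean : ∫ y, W.arithMean y ∂W.ref = 1 := by
  unfold arithMean
  rw [integral_div, integral_add (W.integrable_p 0) (W.integrable_p 1), W.integral_p, W.integral_p]
  norm_num

theorem integrable_geomMean : Integrable W.geomMean W.ref := by
  refine W.integrable_arithMean.mono' ?_ (Filter.Eventually.of_forall fun y => ?_)
  · exact (((W.measurable_p 0).coe_nnreal_real.mul
        (W.measurable_p 1).coe_nnreal_real).sqrt).aestronglyMeasurable
  · rw [Real.norm_of_nonneg (W.geomMean_nonneg y)]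
    exact W.geomMean_le_arithMean y

theorem integral_geomMean : ∫ y, W.geomMean y ∂W.ref = W.bhattacharyya := rfl

theorem bhattacharyya_le_one : W.bhattacharyya ≤ 1 := by
  rw [← W.integral_geomMean, ← W.integral_arithMean]
  exact integral_mono W.integrable_geomMean W.integrable_arithMean W.geomMean_le_arithMean

theorem bhattacharyya_plus : W.plus.bhattacharyya = W.bhattacharyya ^ 2 := by
  have hm := W.measurable_sqrt_p_mul_p 0 1
  have h : ENNReal.ofReal W.plus.bhattacharyya = ENNReal.ofReal (W.bhattacharyya ^ 2) := by
    rw [← lintegral_sqrt_eq_bhattacharyya]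
    have hpt : ∀ z : (Y × Y) × ZMod 2, (NNReal.sqrt (W.plus.p 0 z * W.plus.p 1 z) : ℝ≥0∞) =
        2⁻¹ * ((NNReal.sqrt (W.p 0 z.1.1 * W.p 1 z.1.1) : ℝ≥0∞) *
          (NNReal.sqrt (W.p 0 z.1.2 * W.p 1 z.1.2) : ℝ≥0∞)) := by
      rintro ⟨⟨y, y'⟩, u⟩
      have hu : W.p (u + 0) y * W.p (u + 1) y = W.p 0 y * W.p 1 y := by
        rcases zmod_two_eq_zero_or_one u with rfl | rfl
        · simp
        · simp [CharTwo.add_self_eq_zero, mul_comm]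
      have he : W.plus.p 0 ((y, y'), u) * W.plus.p 1 ((y, y'), u) =
          (2⁻¹ * (NNReal.sqrt (W.p 0 y * W.p 1 y) * NNReal.sqrt (W.p 0 y' * W.p 1 y'))) ^ 2 := by
        rw [mul_pow, mul_pow, NNReal.sq_sqrt, NNReal.sq_sqrt, ← hu]
        simp only [plus]
        rw [one_div]
        ring
      rw [he, NNReal.sqrt_sq]
      simp
    simp_rw [hpt]
    change ∫⁻ z, _ ∂((W.ref.prod W.ref).prod Measure.count) = _
    have hprod : Measurable fun z : Y × Y => (NNReal.sqrt (W.p 0 z.1 * W.p 1 z.1) : ℝ≥0∞) *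
          (NNReal.sqrt (W.p 0 z.2 * W.p 1 z.2) : ℝ≥0∞) :=
      (hm.comp measurable_fst).mul (hm.comp measurable_snd)
    rw [lintegral_prod_symm _ (by exact ((hprod.comp measurable_fst).const_mul _).aemeasurable)]
    simp only
    rw [lintegral_const, lintegral_const_mul _ hprod, lintegral_prod_mul hm.aemeasurable
      hm.aemeasurable, lintegral_sqrt_eq_bhattacharyya, ENNReal.ofReal_pow W.bhattacharyya_nonneg]
    simp [sq, mul_comm _ (2 : ℝ≥0∞), ← mul_assoc, ENNReal.mul_inv_cancel]
  exact (ENNReal.ofReal_eq_ofReal_iff (bhattacharyya_nonneg _) (by positivity)).1 h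

/-- In terms of the geometric mean g and arithmetic mean s at the two outputs, the radicand is g²s'²
+ s²g'² − g²g'². Grouped this way it is a weighted square norm of (s', g'), ready for
`sqrt_le_integral_sqrt`. -/
theorem bhattacharyya_minus_integrand (z : Y × Y) :
    √((W.minus.p 0 z : ℝ) * (W.minus.p 1 z : ℝ)) =
      √(W.geomMean z.1 ^ 2 * W.arithMean z.2 ^ 2 +
        (W.arithMean z.1 ^ 2 - W.geomMean z.1 ^ 2) * W.geomMean z.2 ^ 2) := by
  have h11 : (1 : ZMod 2) + 1 = 0 := by decide
  have hsum : ∀ f : ZMod 2 → ℝ≥0, ∑ u, f u = f 0 + f 1 := fun f => Fin.sum_univ_two f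
  congr 1
  simp only [minus, hsum, geomMean_sq, arithMean, h11, zero_add, add_zero]
  push_cast
  ring

/-- The square of the right side exceeds the radicand by 2gg'(s − g)(s' − g') ≥ 0. -/
theorem bhattacharyya_minus_integrand_le (z : Y × Y) :
    √((W.minus.p 0 z : ℝ) * (W.minus.p 1 z : ℝ)) ≤
      W.geomMean z.1 * W.arithMean z.2 + W.arithMean z.1 * W.geomMean z.2 -
        W.geomMean z.1 * W.geomMean z.2 := by
  have h1 := W.geomMean_nonneg z.1
  have h2 := W.geomMean_nonneg z.2
  have h3 := sub_nonneg.2 (W.geomMean_le_arithMean z.1)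
  have h4 := sub_nonneg.2 (W.geomMean_le_arithMean z.2)
  rw [bhattacharyya_minus_integrand]
  refine Real.sqrt_le_iff.2 ⟨by nlinarith [mul_nonneg h1 h4, mul_nonneg h3 h2, mul_nonneg h1 h2], ?_⟩
  nlinarith [mul_nonneg (mul_nonneg h1 h2) (mul_nonneg h3 h4)]

theorem integrable_minus_bound : Integrable (fun z : Y × Y => W.geomMean z.1 * W.arithMean z.2 +
    W.arithMean z.1 * W.geomMean z.2 - W.geomMean z.1 * W.geomMean z.2) (W.ref.prod W.ref) :=
  ((W.integrable_geomMean.mul_prod W.integrable_arithMean).add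
    (W.integrable_arithMean.mul_prod W.integrable_geomMean)).sub
    (W.integrable_geomMean.mul_prod W.integrable_geomMean)

theorem bhattacharyya_minus_le :
    W.minus.bhattacharyya ≤ 2 * W.bhattacharyya - W.bhattacharyya ^ 2 := by
  have h : ∫ z : Y × Y, (W.geomMean z.1 * W.arithMean z.2 +
      W.arithMean z.1 * W.geomMean z.2 - W.geomMean z.1 * W.geomMean z.2) ∂(W.ref.prod W.ref) =
      2 * W.bhattacharyya - W.bhattacharyya ^ 2 := by
    have i1 := W.integrable_geomMean.mul_prod W.integrable_arithMean
    have i2 := W.integrable_arithMean.mul_prod W.integrable_geomMean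
    have i3 := W.integrable_geomMean.mul_prod W.integrable_geomMean
    rw [integral_sub (by exact i1.add i2) i3, integral_add i1 i2, integral_prod_mul, integral_prod_mul,
      integral_prod_mul, integral_arithMean, integral_geomMean]
    ring
  rw [← h]
  exact integral_mono_of_nonneg (Filter.Eventually.of_forall fun _ => Real.sqrt_nonneg _)
    W.integrable_minus_bound (Filter.Eventually.of_forall W.bhattacharyya_minus_integrand_le)

/-- `sqrt_le_integral_sqrt` is used twice: integrating over the second output leaves √(g² + (s² −
g²)Z²), which equals √(Z²s² + (1 − Z²)g²) and is again of the required form. The result says that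
under the minus transform Z² grows at least as an erasure probability would. -/
theorem le_bhattacharyya_minus_sq :
    2 * W.bhattacharyya ^ 2 - (W.bhattacharyya ^ 2) ^ 2 ≤ W.minus.bhattacharyya ^ 2 := by
  set Z := W.bhattacharyya with hZ
  have hZ1 := W.bhattacharyya_le_one
  have hZ0 := W.bhattacharyya_nonneg
  have hb : ∀ y, 0 ≤ W.arithMean y ^ 2 - W.geomMean y ^ 2 := fun y =>
    sub_nonneg.2 (pow_le_pow_left₀ (W.geomMean_nonneg y) (W.geomMean_le_arithMean y) 2)
  have hin := fun y => sqrt_le_integral_sqrt W.integrable_arithMean W.integrable_geomMean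
    W.arithMean_nonneg W.geomMean_nonneg W.integral_arithMean W.integral_geomMean
    (sq_nonneg (W.geomMean y)) (hb y)
  have hout := sqrt_le_integral_sqrt W.integrable_arithMean W.integrable_geomMean
    W.arithMean_nonneg W.geomMean_nonneg W.integral_arithMean W.integral_geomMean
    (sq_nonneg Z) (show 0 ≤ 1 - Z ^ 2 by nlinarith)
  have hint : Integrable (fun z : Y × Y => √(W.geomMean z.1 ^ 2 * W.arithMean z.2 ^ 2 +
        (W.arithMean z.1 ^ 2 - W.geomMean z.1 ^ 2) * W.geomMean z.2 ^ 2)) (W.ref.prod W.ref) := by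
    refine W.integrable_minus_bound.mono' ?_ (Filter.Eventually.of_forall fun z => ?_)
    · simp_rw [← bhattacharyya_minus_integrand]
      exact (((W.minus.measurable_p 0).coe_nnreal_real.mul
        (W.minus.measurable_p 1).coe_nnreal_real).sqrt).aestronglyMeasurable
    · rw [Real.norm_of_nonneg (Real.sqrt_nonneg _), ← bhattacharyya_minus_integrand]
      exact W.bhattacharyya_minus_integrand_le z
  have hle : √(Z ^ 2 + (1 - Z ^ 2) * Z ^ 2) ≤ W.minus.bhattacharyya := by
    refine hout.2.trans ?_
    unfold bhattacharyya
    simp_rw [bhattacharyya_minus_integrand]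
    change _ ≤ ∫ z, _ ∂(W.ref.prod W.ref)
    rw [integral_prod _ hint]
    refine integral_mono hout.1 hint.integral_prod_left fun y => ?_
    refine le_trans (le_of_eq ?_) (hin y).2
    change √_ = √_
    congr 1
    rw [hZ]
    ring
  calc _ = √(Z ^ 2 + (1 - Z ^ 2) * Z ^ 2) ^ 2 := by
        rw [Real.sq_sqrt (by nlinarith [mul_nonneg (sq_nonneg Z) (show 0 ≤ 1 - Z ^ 2 by nlinarith)])]
        ring
    _ ≤ _ := pow_le_pow_left₀ (Real.sqrt_nonneg _) hle 2

theorem bhattacharyya_plus_mem_Ioo (h : W.bhattacharyya ∈ Ioo (0 : ℝ) 1) :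
    W.plus.bhattacharyya ∈ Ioo (0 : ℝ) 1 := by
  rw [bhattacharyya_plus]
  exact ⟨pow_pos h.1 2, pow_lt_one₀ h.1.le h.2 two_ne_zero⟩

theorem bhattacharyya_minus_mem_Ioo (h : W.bhattacharyya ∈ Ioo (0 : ℝ) 1) :
    W.minus.bhattacharyya ∈ Ioo (0 : ℝ) 1 := by
  have h1 := W.bhattacharyya_minus_le
  have h2 := W.le_bhattacharyya_minus_sq
  have h3 := W.minus.bhattacharyya_nonneg
  obtain ⟨ha, hb⟩ := h
  have hsq : W.bhattacharyya ^ 2 < 1 := pow_lt_one₀ ha.le hb two_ne_zero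
  constructor
  · rcases h3.eq_or_lt with h0 | h0
    · rw [← h0] at h2
      nlinarith [pow_pos ha 2]
    · exact h0
  · nlinarith

/-! ### The selected indices form an upper set -/

/-- The Bhattacharyya parameter of a synthetic channel of the erasure channel. -/
noncomputable def erasureEvolution : (n : ℕ) → (Fin n → Fin 2) → ℝ → ℝ
  | 0, _, x => x
  | n + 1, b, x => erasureEvolution n (Fin.tail b) (if b 0 = 0 then 2 * x - x ^ 2 else x ^ 2)

theorem erasureStep_mem (p : Prop) [Decidable p] {x : ℝ} (hx : x ∈ Icc (0 : ℝ) 1) :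
    (if p then 2 * x - x ^ 2 else x ^ 2) ∈ Icc (0 : ℝ) 1 := by
  obtain ⟨h0, h1⟩ := hx
  split_ifs
  · exact ⟨by nlinarith, by nlinarith [sq_nonneg (1 - x)]⟩
  · exact ⟨by positivity, by nlinarith⟩

theorem strictMonoOn_erasureEvolution (n : ℕ) (b : Fin n → Fin 2) :
    StrictMonoOn (erasureEvolution n b) (Icc 0 1) := by
  induction n with
  | zero => exact fun x _ y _ h => h
  | succ n ih =>
    intro x hx y hy hxy
    refine ih (Fin.tail b) (erasureStep_mem _ hx) (erasureStep_mem _ hy) ?_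
    obtain ⟨hx0, hx1⟩ := hx
    obtain ⟨hy0, hy1⟩ := hy
    split_ifs
    · nlinarith
    · nlinarith

theorem bhattacharyya_mem_Icc : W.bhattacharyya ∈ Icc (0 : ℝ) 1 :=
  ⟨W.bhattacharyya_nonneg, W.bhattacharyya_le_one⟩

theorem bhattacharyya_sq_mem_Icc : W.bhattacharyya ^ 2 ∈ Icc (0 : ℝ) 1 :=
  ⟨sq_nonneg _, pow_le_one₀ W.bhattacharyya_nonneg W.bhattacharyya_le_one⟩

theorem syntheticBhattacharyya_mem_Icc (n : ℕ) (b : Fin n → Fin 2) {Y : Type u}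
    [MeasurableSpace Y] (W : BinaryChannel Y) :
    syntheticBhattacharyya n b W ∈ Icc (0 : ℝ) 1 := by
  induction n generalizing Y with
  | zero => exact W.bhattacharyya_mem_Icc
  | succ n ih =>
    rw [syntheticBhattacharyya]
    split_ifs
    · exact ih _ _
    · exact ih _ _

/-- Plus squares Z exactly, minus gives at most 2Z − Z², and the erasure evolution is monotone.
`le_syntheticBhattacharyya_sq` is the matching lower bound for the square. -/
theorem syntheticBhattacharyya_le (n : ℕ) (b : Fin n → Fin 2) {Y : Type u}
    [MeasurableSpace Y] (W : BinaryChannel Y) :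
    syntheticBhattacharyya n b W ≤ erasureEvolution n b W.bhattacharyya := by
  induction n generalizing Y with
  | zero => exact le_rfl
  | succ n ih =>
    rw [syntheticBhattacharyya, erasureEvolution]
    have hmem := erasureStep_mem (b 0 = 0) W.bhattacharyya_mem_Icc
    split_ifs at hmem ⊢
    · exact (ih _ _).trans ((strictMonoOn_erasureEvolution n _).monotoneOn
        W.minus.bhattacharyya_mem_Icc hmem W.bhattacharyya_minus_le)
    · exact (ih _ _).trans_eq (by rw [bhattacharyya_plus])

theorem le_syntheticBhattacharyya_sq (n : ℕ) (b : Fin n → Fin 2) {Y : Type u}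
    [MeasurableSpace Y] (W : BinaryChannel Y) :
    erasureEvolution n b (W.bhattacharyya ^ 2) ≤ syntheticBhattacharyya n b W ^ 2 := by
  induction n generalizing Y with
  | zero => exact le_rfl
  | succ n ih =>
    rw [syntheticBhattacharyya, erasureEvolution]
    have hmem := erasureStep_mem (b 0 = 0) W.bhattacharyya_sq_mem_Icc
    split_ifs at hmem ⊢
    · exact ((strictMonoOn_erasureEvolution n _).monotoneOn hmem
        W.minus.bhattacharyya_sq_mem_Icc W.le_bhattacharyya_minus_sq).trans (ih _ _)
    · exact le_trans (by rw [bhattacharyya_plus]) (ih _ _)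

/-- Replacing a minus transform by a plus transform strictly decreases the Bhattacharyya
parameter of the synthetic channel. -/
theorem syntheticBhattacharyya_update_lt (n : ℕ) (b : Fin n → Fin 2) (j : Fin n) (hj : b j = 0)
    {Y : Type u} [MeasurableSpace Y] (W : BinaryChannel Y)
    (hW : W.bhattacharyya ∈ Ioo (0 : ℝ) 1) :
    syntheticBhattacharyya n (Function.update b j 1) W < syntheticBhattacharyya n b W := by
  induction n generalizing Y with
  | zero => exact j.elim0
  | succ n ih =>
    rw [syntheticBhattacharyya, syntheticBhattacharyya]
    rcases Fin.eq_zero_or_eq_succ j with rfl | ⟨k, rfl⟩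
    · rw [Fin.tail_update_zero, Function.update_self, if_neg (by decide), if_pos hj]
      have hsq := W.bhattacharyya_sq_mem_Icc
      have hstep : 2 * W.bhattacharyya ^ 2 - (W.bhattacharyya ^ 2) ^ 2 ∈ Icc (0 : ℝ) 1 := by
        simpa using erasureStep_mem True hsq
      have hlt : W.bhattacharyya ^ 2 <
          2 * W.bhattacharyya ^ 2 - (W.bhattacharyya ^ 2) ^ 2 := by
        have h1 : W.bhattacharyya ^ 2 < 1 := pow_lt_one₀ hW.1.le hW.2 two_ne_zero
        nlinarith [pow_pos hW.1 2]
      have hm := syntheticBhattacharyya_mem_Icc n (Fin.tail b) W.minus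
      -- Both sides are compared with erasure evolutions: from Z² after a plus, from at least 2Z² −
      -- Z⁴ for the square after a minus. The latter start is strictly larger, and a square of a
      -- number in [0, 1] is at most that number.
      calc _ ≤ erasureEvolution n (Fin.tail b) (W.bhattacharyya ^ 2) := by
            rw [← bhattacharyya_plus]; exact syntheticBhattacharyya_le _ _ _
        _ < erasureEvolution n (Fin.tail b)
            (2 * W.bhattacharyya ^ 2 - (W.bhattacharyya ^ 2) ^ 2) :=
          strictMonoOn_erasureEvolution n _ hsq hstep hlt
        _ ≤ erasureEvolution n (Fin.tail b) (W.minus.bhattacharyya ^ 2) :=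
          (strictMonoOn_erasureEvolution n _).monotoneOn hstep
            W.minus.bhattacharyya_sq_mem_Icc W.le_bhattacharyya_minus_sq
        _ ≤ syntheticBhattacharyya n (Fin.tail b) W.minus ^ 2 := le_syntheticBhattacharyya_sq _ _ _
        _ ≤ _ := by nlinarith [hm.1, hm.2]
    · rw [Fin.tail_update_succ, Function.update_of_ne (Fin.succ_ne_zero k).symm]
      split_ifs
      · exact ih _ k hj _ (W.bhattacharyya_minus_mem_Ioo hW)
      · exact ih _ k hj _ (W.bhattacharyya_plus_mem_Ioo hW)

/-- A set of indices with the smallest Bhattacharyya parameters is an upper set. -/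
theorem isUpperSet_of_syntheticBhattacharyya_le (hW : W.bhattacharyya ∈ Ioo (0 : ℝ) 1) {n : ℕ}
    {A : Set (Fin n → Fin 2)} (hA : ∀ i ∈ A, ∀ j ∉ A,
      W.syntheticBhattacharyya n i ≤ W.syntheticBhattacharyya n j) : IsUpperSet A := by
  classical
  intro b b' hbb' hb
  -- Strictness of the comparison matters: it excludes that a tie is broken against the index with
  -- more plus transforms.
  have hstep : ∀ c ∈ A, ∀ j, c j ≤ b' j → Function.update c j (b' j) ∈ A := by
    intro c hc j hj
    by_cases he : c j = b' j
    · rwa [← he, Function.update_eq_self]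
    · have h0 : c j = 0 ∧ b' j = 1 := by
        generalize c j = s at *
        generalize b' j = t at *
        revert s t; decide
      rw [h0.2]
      by_contra hcon
      exact absurd (hA c hc _ hcon)
        (not_le.2 (syntheticBhattacharyya_update_lt n c j h0.1 W hW))
  have hfin : ∀ S : Finset (Fin n), (fun j => if j ∈ S then b' j else b j) ∈ A := by
    intro S
    induction S using Finset.induction_on with
    | empty => simpa using hb
    | insert i S hi ih =>
      have := hstep _ ih i (by simpa [hi] using hbb' i)
      convert this using 1
      funext j
      by_cases hj : j = i
      · subst hj; simp
      · simp [hj]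
  simpa using hfin Finset.univ

end BinaryChannel

/-! ### Row weights and minimum distance -/

theorem fin_two_eq_zero_or_one (a : Fin 2) : a = 0 ∨ a = 1 := by revert a; decide

/-- The number of ones in the binary expansion `b`. -/
def onesCount {n : ℕ} (b : Fin n → Fin 2) : ℕ := ∑ j, (b j : ℕ)

/-- The code generated by the rows of weight at least `2 ^ t` of the polar matrix. -/
def rowWeightCode (n t : ℕ) : Submodule (ZMod 2) ((Fin n → Fin 2) → ZMod 2) :=
  Submodule.span (ZMod 2) (polarMatrix n '' {b | t ≤ onesCount b})

theorem polarMatrix_mem_rowWeightCode {n t : ℕ} {b : Fin n → Fin 2} (hb : t ≤ onesCount b) :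
    polarMatrix n b ∈ rowWeightCode n t :=
  Submodule.subset_span ⟨b, hb, rfl⟩

theorem onesCount_succ {n : ℕ} (b : Fin (n + 1) → Fin 2) :
    onesCount b = b 0 + onesCount (Fin.tail b) := by
  rw [onesCount, Fin.sum_univ_succ]; rfl

theorem polarMatrix_succ_cons {n : ℕ} (b : Fin (n + 1) → Fin 2) (e : Fin 2) (x : Fin n → Fin 2) :
    polarMatrix (n + 1) b (Fin.cons e x) =
      (!![1, 0; 1, 1] : Matrix (Fin 2) (Fin 2) (ZMod 2)) (b 0) e * polarMatrix n (Fin.tail b) x := by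
  rw [polarMatrix, Fin.prod_univ_succ]
  simp [polarMatrix, Fin.tail]

theorem hammingNorm_eq_add_cons {n : ℕ} (c : (Fin (n + 1) → Fin 2) → ZMod 2) :
    hammingNorm c = hammingNorm (fun x : Fin n → Fin 2 => c (Fin.cons 0 x)) +
      hammingNorm (fun x : Fin n → Fin 2 => c (Fin.cons 1 x)) := by
  simp only [hammingNorm, Finset.card_filter]
  rw [← (Fin.consEquiv fun _ => Fin 2).sum_comp, Fintype.sum_prod_type, Fin.sum_univ_two]
  rfl

theorem hammingNorm_add_le {ι : Type*} [Fintype ι] (a b : ι → ZMod 2) :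
    hammingNorm (a + b) ≤ hammingNorm a + hammingNorm b := by
  have hneg : ∀ x : ι → ZMod 2, -x = x := fun x => funext fun i => CharTwo.neg_eq (x i)
  have h := hammingDist_triangle a 0 b
  rwa [hammingDist_eq_hammingNorm, hneg, hammingDist_zero_right, hammingDist_zero_left] at h

/-- The Reed–Muller distance bound by the (u | u + v) recursion. The second half of `c` lies in the
code with t − 1, the sum of the halves in the code with t. If the sum vanishes, the halves are equal
and the weight of one is counted twice; otherwise the sum bounds the weight from below. -/
theorem two_pow_le_hammingNorm {n t : ℕ} {c : (Fin n → Fin 2) → ZMod 2}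
    (hc : c ∈ rowWeightCode n t) (hc0 : c ≠ 0) : 2 ^ t ≤ hammingNorm c := by
  induction n generalizing t with
  | zero =>
    rcases Nat.eq_zero_or_pos t with rfl | ht
    · exact hammingNorm_pos_iff.2 hc0
    · have hle : rowWeightCode 0 t ≤ ⊥ := by
        refine Submodule.span_le.2 ?_
        rintro _ ⟨b, hb, rfl⟩
        simp only [mem_ofPred_eq, onesCount, Finset.univ_eq_empty, Finset.sum_empty] at hb
        omega
      exact absurd ((Submodule.mem_bot _).1 (hle hc)) hc0
  | succ n ih =>
    rcases Nat.eq_zero_or_pos t with rfl | ht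
    · exact hammingNorm_pos_iff.2 hc0
    let r : Fin 2 → ((Fin (n + 1) → Fin 2) → ZMod 2) →ₗ[ZMod 2] ((Fin n → Fin 2) → ZMod 2) :=
      fun e => LinearMap.funLeft (ZMod 2) (ZMod 2) fun x : Fin n → Fin 2 => Fin.cons e x
    have hrow : ∀ b e, r e (polarMatrix (n + 1) b) =
        (!![1, 0; 1, 1] : Matrix (Fin 2) (Fin 2) (ZMod 2)) (b 0) e • polarMatrix n (Fin.tail b) :=
      fun b e => funext fun x => polarMatrix_succ_cons b e x
    have hr1 : r 1 c ∈ rowWeightCode n (t - 1) := by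
      have hle : rowWeightCode (n + 1) t ≤ (rowWeightCode n (t - 1)).comap (r 1) := by
        refine Submodule.span_le.2 ?_
        rintro _ ⟨b, hb, rfl⟩
        rw [mem_ofPred_eq, onesCount_succ] at hb
        refine (?_ : r 1 _ ∈ rowWeightCode n (t - 1))
        rw [hrow]
        exact Submodule.smul_mem _ _ (polarMatrix_mem_rowWeightCode (by omega))
      exact hle hc
    have hr01 : r 0 c + r 1 c ∈ rowWeightCode n t := by
      have hle : rowWeightCode (n + 1) t ≤ (rowWeightCode n t).comap (r 0 + r 1) := by
        refine Submodule.span_le.2 ?_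
        rintro _ ⟨b, hb, rfl⟩
        rw [mem_ofPred_eq, onesCount_succ] at hb
        refine (?_ : r 0 _ + r 1 _ ∈ rowWeightCode n t)
        rw [hrow, hrow, ← add_smul]
        rcases fin_two_eq_zero_or_one (b 0) with h0 | h0
        · rw [h0] at hb
          exact Submodule.smul_mem _ _ (polarMatrix_mem_rowWeightCode (by simpa using hb))
        · have h2 : (!![1, 0; 1, 1] : Matrix (Fin 2) (Fin 2) (ZMod 2)) (b 0) 0 +
              (!![1, 0; 1, 1] : Matrix (Fin 2) (Fin 2) (ZMod 2)) (b 0) 1 = 0 := by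
            rw [h0]; decide
          rw [h2, zero_smul]
          exact Submodule.zero_mem _
      exact hle hc
    have hnorm : hammingNorm c = hammingNorm (r 0 c) + hammingNorm (r 1 c) :=
      hammingNorm_eq_add_cons c
    by_cases h1 : r 1 c = 0
    · have h0 : r 0 c ≠ 0 := by
        intro h0
        rw [h0, h1] at hnorm
        simp only [hammingNorm_zero, add_zero] at hnorm
        exact hc0 (hammingNorm_eq_zero.1 hnorm)
      rw [h1, add_zero] at hr01
      exact (ih hr01 h0).trans (by omega)
    · by_cases h01 : r 0 c + r 1 c = 0
      · have he : r 0 c = r 1 c := by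
          rw [← sub_eq_zero, sub_eq_add_neg,
            show -(r 1 c) = r 1 c from funext fun i => CharTwo.neg_eq _, h01]
        have := ih hr1 h1
        obtain ⟨s, rfl⟩ : ∃ s, t = s + 1 := ⟨t - 1, by omega⟩
        rw [hnorm, he, pow_succ]
        simp only [Nat.add_sub_cancel] at this
        omega
      · exact (ih hr01 h01).trans ((hammingNorm_add_le _ _).trans hnorm.ge)

theorem lt_hammingNorm_of_mem_span {n : ℕ} {A : Set (Fin n → Fin 2)} {d : ℝ}
    (hA : ∀ b ∈ A, d < (2 : ℝ) ^ onesCount b) {c : (Fin n → Fin 2) → ZMod 2}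
    (hc : c ∈ Submodule.span (ZMod 2) (polarMatrix n '' A)) (hc0 : c ≠ 0) :
    d < hammingNorm c := by
  have hne : A.Nonempty := by
    by_contra hcon
    have hle : Submodule.span (ZMod 2) (polarMatrix n '' A) ≤ ⊥ := by
      refine Submodule.span_le.2 ?_
      rintro _ ⟨b, hb, rfl⟩
      exact absurd ⟨b, hb⟩ hcon
    exact hc0 ((Submodule.mem_bot _).1 (hle hc))
  obtain ⟨b, hb, hmin⟩ := exists_min_image A onesCount (Set.toFinite A) hne
  have hle := two_pow_le_hammingNorm (Submodule.span_mono (image_mono fun b' hb' => hmin b' hb') hc)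
    hc0
  exact (hA b hb).trans_le (by exact_mod_cast hle)

/-! ### Many disjoint codewords from one light row -/

/-- The indicator of the subcube of the points that agree with `a` where `b` vanishes. -/
def subcubeIndicator {n : ℕ} (b a : Fin n → Fin 2) : (Fin n → Fin 2) → ZMod 2 :=
  fun x => if ∀ j, b j = 0 → x j = a j then 1 else 0

theorem subcubeIndicator_ne_zero_iff {n : ℕ} (b a x : Fin n → Fin 2) :
    subcubeIndicator b a x ≠ 0 ↔ ∀ j, b j = 0 → x j = a j := by
  rw [subcubeIndicator]
  split_ifs with h
  · simpa using h
  · simpa using h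

/-- The indicator is a product over coordinates. A free coordinate gives (1,1), the row 1 of F; a
coordinate fixed to 0 gives (1,0), the row 0; one fixed to 1 gives (0,1), the sum of both rows.
Expanding the product yields rows with index at least `b`. -/
theorem subcubeIndicator_mem_span {n : ℕ} (b a : Fin n → Fin 2) {A : Set (Fin n → Fin 2)}
    (hA : ∀ b', b ≤ b' → b' ∈ A) :
    subcubeIndicator b a ∈ Submodule.span (ZMod 2) (polarMatrix n '' A) := by
  let t : Fin n → Finset (Fin 2) :=
    fun j => if b j = 1 then {1} else if a j = 0 then {0} else Finset.univ
  have hfac : ∀ β α ξ : Fin 2, (∑ e ∈ (if β = 1 then {1} else if α = 0 then {0} else Finset.univ :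
      Finset (Fin 2)), (!![1, 0; 1, 1] : Matrix (Fin 2) (Fin 2) (ZMod 2)) e ξ) =
      if (β = 0 → ξ = α) then 1 else 0 := by decide
  have hsum : subcubeIndicator b a = ∑ f ∈ Fintype.piFinset t, fun x => polarMatrix n f x := by
    funext x
    rw [Finset.sum_apply]
    simp only [polarMatrix]
    rw [← Finset.prod_univ_sum t fun j e =>
      (!![1, 0; 1, 1] : Matrix (Fin 2) (Fin 2) (ZMod 2)) e (x j)]
    simp only [t, hfac, Finset.prod_boole]
    simp [subcubeIndicator]
  rw [hsum]
  refine Submodule.sum_mem _ fun f hf => Submodule.subset_span ⟨f, hA f fun j => ?_, rfl⟩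
  have hj := Fintype.mem_piFinset.1 hf j
  rcases fin_two_eq_zero_or_one (b j) with h | h
  · rw [h]; exact Fin.zero_le _
  · simp only [t, h, if_true, Finset.mem_singleton] at hj
    rw [h, hj]

theorem hammingNorm_subcubeIndicator {n : ℕ} (b a : Fin n → Fin 2) :
    hammingNorm (subcubeIndicator b a) = 2 ^ onesCount b := by
  have h : (Finset.univ.filter fun x => subcubeIndicator b a x ≠ 0) =
      Fintype.piFinset fun j => if b j = 0 then {a j} else Finset.univ := by
    ext x
    rw [Finset.mem_filter, subcubeIndicator_ne_zero_iff, Fintype.mem_piFinset]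
    simp only [Finset.mem_univ, true_and]
    refine forall_congr' fun j => ?_
    by_cases hj : b j = 0 <;> simp [hj]
  rw [hammingNorm, h, Fintype.card_piFinset, onesCount, ← Finset.prod_pow_eq_pow_sum]
  refine Finset.prod_congr rfl fun j _ => ?_
  rcases fin_two_eq_zero_or_one (b j) with hj | hj <;> simp [hj]

/-- Representatives of the translates of the subcube spanned by `b`. -/
def translates {n : ℕ} (b : Fin n → Fin 2) : Finset (Fin n → Fin 2) :=
  Fintype.piFinset fun j => if b j = 0 then Finset.univ else {0}

theorem card_translates_mul {n : ℕ} (b : Fin n → Fin 2) :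
    (translates b).card * 2 ^ onesCount b = 2 ^ n := by
  rw [translates, Fintype.card_piFinset, onesCount, ← Finset.prod_pow_eq_pow_sum,
    ← Finset.prod_mul_distrib]
  rw [Finset.prod_congr rfl (g := fun _ => 2) fun j _ => ?_]
  · simp
  · rcases fin_two_eq_zero_or_one (b j) with hj | hj <;> simp [hj]

theorem disjoint_support_subcubeIndicator {n : ℕ} {b a a' : Fin n → Fin 2}
    (ha : a ∈ translates b) (ha' : a' ∈ translates b) (hne : a ≠ a') :
    Disjoint (Finset.univ.filter fun x => subcubeIndicator b a x ≠ 0)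
      (Finset.univ.filter fun x => subcubeIndicator b a' x ≠ 0) := by
  rw [Finset.disjoint_filter]
  intro x _ h h'
  rw [subcubeIndicator_ne_zero_iff] at h h'
  refine hne (funext fun j => ?_)
  have h1 := Fintype.mem_piFinset.1 ha j
  have h2 := Fintype.mem_piFinset.1 ha' j
  by_cases hj : b j = 0
  · rw [← h j hj, h' j hj]
  · simp only [hj, if_false, Finset.mem_singleton] at h1 h2
    rw [h1, h2]

/-- Each confusion event depends only on the coordinates in the support of its codeword. -/
theorem indepFun_indicator_confusionSet {ι : Type*} [Fintype ι] (μ : Measure ℝ≥0)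
    [IsProbabilityMeasure μ] {c c' : ι → ZMod 2}
    (hdisj : Disjoint (Finset.univ.filter fun i => c i ≠ 0)
      (Finset.univ.filter fun i => c' i ≠ 0)) :
    ProbabilityTheory.IndepFun ((confusionSet c).indicator (1 : (ι → ℝ≥0) → ℝ))
      ((confusionSet c').indicator (1 : (ι → ℝ≥0) → ℝ)) (Measure.pi fun _ : ι => μ) := by
  classical
  have hi := ProbabilityTheory.iIndepFun_pi (μ := fun _ : ι => μ) (X := fun _ r => r)
    fun _ => aemeasurable_id
  have hf := hi.indepFun_finset _ _ hdisj fun i => measurable_pi_apply i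
  let φ : (S : Finset ι) → (S → ℝ≥0) → ℝ := fun S => {w : S → ℝ≥0 | 1 ≤ ∏ i, w i}.indicator 1
  have hφ : ∀ S, Measurable (φ S) := fun S => measurable_one.indicator
    (measurableSet_le measurable_const
      (Finset.measurable_fun_prod _ fun i _ => measurable_pi_apply i))
  have hcomp : ∀ e : ι → ZMod 2, (confusionSet e).indicator (1 : (ι → ℝ≥0) → ℝ) =
      φ (Finset.univ.filter fun i => e i ≠ 0) ∘
        fun z (i : {i // i ∈ Finset.univ.filter fun i => e i ≠ 0}) => z i := by
    intro e
    funext z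
    simp only [φ, Function.comp, indicator, confusionSet, mem_ofPred_eq, Pi.one_apply]
    rw [Finset.prod_coe_sort (Finset.univ.filter fun i => e i ≠ 0) z]
    congr
  rw [hcomp c, hcomp c']
  exact hf.comp (hφ _) (hφ _)

/-- A code that contains all translates of a subcube with many translates has a large probability
of list decoding failure. -/
theorem half_le_listErrorSet_of_subcube {n : ℕ} (μ : Measure ℝ≥0) [IsProbabilityMeasure μ]
    {C : Submodule (ZMod 2) ((Fin n → Fin 2) → ZMod 2)} {b : Fin n → Fin 2}
    (hC : ∀ a, subcubeIndicator b a ∈ C) {p : ℝ}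
    (hp : ∀ a, p ≤ (Measure.pi fun _ : Fin n → Fin 2 => μ).real
      (confusionSet (subcubeIndicator b a)))
    {K : ℕ} (hK : 1 ≤ K) (hKp : 4 * (K : ℝ) ≤ (translates b).card * p) :
    1 / 2 ≤ (Measure.pi fun _ : Fin n → Fin 2 => μ).real (listErrorSet C K) := by
  classical
  have hne : ∀ a, subcubeIndicator b a ≠ 0 := fun a h => by
    have h1 := hammingNorm_subcubeIndicator b a
    rw [h, hammingNorm_zero] at h1
    exact (pow_pos two_pos _).ne h1
  have hinj : ∀ a ∈ translates b, ∀ a' ∈ translates b,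
      subcubeIndicator b a = subcubeIndicator b a' → a = a' := by
    intro a ha a' ha' he
    by_contra hcon
    have hd := disjoint_support_subcubeIndicator ha ha' hcon
    rw [he, disjoint_self, Finset.bot_eq_empty, Finset.filter_eq_empty_iff] at hd
    exact hne a' (funext fun x => by simpa using hd (Finset.mem_univ x))
  refine half_le_measureReal_card _ (translates b)
    (fun a => confusionSet (subcubeIndicator b a)) (fun a _ => measurableSet_confusionSet _)
    (fun a ha a' ha' hn => indepFun_indicator_confusionSet μ
      (disjoint_support_subcubeIndicator ha ha' hn)) hK ?_ ?_
  · refine hKp.trans ?_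
    rw [← nsmul_eq_mul]
    exact Finset.card_nsmul_le_sum _ _ _ fun a _ => hp a
  · rintro z ⟨S, hS, hcard, hz⟩
    rw [mem_listErrorSet_iff]
    refine ⟨S.image (subcubeIndicator b), ?_, fun c hc => ?_⟩
    · rw [Finset.card_image_of_injOn fun a ha a' ha' => hinj a (hS ha) a' (hS ha'), hcard]
    · obtain ⟨a, ha, rfl⟩ := Finset.mem_image.1 hc
      exact ⟨hC a, hne a, hz a ha⟩

/-! ### The block length threshold -/

theorem rpow_log_div_log {Z x : ℝ} (hZ : Z ∈ Ioo (0 : ℝ) 1) (hx : 0 < x) (k : ℕ) :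
    Z ^ ((k * Real.log x) / Real.log Z) = x ^ k := by
  rw [Real.rpow_def_of_pos hZ.1, mul_div_cancel₀ _ (Real.log_neg hZ.1 hZ.2).ne,
    ← Real.log_pow, Real.exp_log (pow_pos hx k)]

/-- With x = P/8 and d = ln x / ln Z, the power of Z inside m̄ is x⁴, so 2^m̄ = 2d · ln(1 − Z)/ln(1
− x⁴). The condition d ≥ 1 means x ≤ Z, whence −ln(1 − Z) ≥ x, while −ln(1 − x⁴) ≤ 2x⁴. -/
theorem div_cube_le_two_rpow_mBar {Z P : ℝ} (hZ : Z ∈ Ioo (0 : ℝ) 1) (hP : P ∈ Ioo (0 : ℝ) 1)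
    (hd : 1 ≤ Real.log (P / 8) / Real.log Z) :
    Real.log (P / 8) / Real.log Z / (P / 8) ^ 3 ≤ (2 : ℝ) ^ mBar Z P := by
  set x := P / 8 with hx
  have hx0 : 0 < x := by have := hP.1; positivity
  have hx1 : x < 1 / 8 := by have := hP.2; rw [hx]; linarith
  set d := Real.log x / Real.log Z with hd'
  have hlogZ := Real.log_neg hZ.1 hZ.2
  have hxZ : x ≤ Z := by
    rw [hd', le_div_iff_of_neg hlogZ, one_mul] at hd
    exact (Real.log_le_log_iff hx0 hZ.1).1 hd
  have hx4 : x ^ 4 ≤ 1 / 2 := by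
    calc x ^ 4 ≤ (1 / 8) ^ 4 := pow_le_pow_left₀ hx0.le hx1.le 4
      _ ≤ 1 / 2 := by norm_num
  have hx4pos : 0 < x ^ 4 := pow_pos hx0 4
  have hnum : x ≤ -Real.log (1 - Z) := by
    have := Real.log_le_sub_one_of_pos (sub_pos.2 hZ.2)
    linarith
  have hden0 : 0 < -Real.log (1 - x ^ 4) := by
    have := Real.log_neg (show 0 < 1 - x ^ 4 by linarith) (by linarith)
    linarith
  have hden : -Real.log (1 - x ^ 4) ≤ 2 * x ^ 4 := by
    have h1 := Real.one_sub_inv_le_log_of_pos (show 0 < 1 - x ^ 4 by linarith)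
    have h2 : (1 - x ^ 4)⁻¹ ≤ 1 + 2 * x ^ 4 := by
      rw [inv_le_iff_one_le_mul₀ (by linarith)]
      nlinarith
    linarith
  have hQ : (2 * Real.log x * Real.log (1 - Z)) /
      (Real.log Z * Real.log (1 - Z ^ ((4 * Real.log x) / Real.log Z))) =
      2 * d * (-Real.log (1 - Z) / -Real.log (1 - x ^ 4)) := by
    have h4 := rpow_log_div_log hZ hx0 4
    push_cast at h4
    rw [h4, neg_div_neg_eq, hd']
    field_simp
  have hratio : 1 / (2 * x ^ 3) ≤ -Real.log (1 - Z) / -Real.log (1 - x ^ 4) := by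
    rw [div_le_div_iff₀ (by positivity) hden0]
    have h3 : 0 < 2 * x ^ 3 := by positivity
    nlinarith [mul_le_mul_of_nonneg_right hnum h3.le]
  have hle : d / x ^ 3 ≤ 2 * d * (-Real.log (1 - Z) / -Real.log (1 - x ^ 4)) := by
    calc d / x ^ 3 = 2 * d * (1 / (2 * x ^ 3)) := by field_simp
      _ ≤ _ := by gcongr
  have hpos : 0 < d / x ^ 3 := by positivity
  rw [mBar, ← hx, hQ, Real.rpow_logb two_pos (by norm_num) (hpos.trans_le hle)]
  exact hle

/-- The expected number of confused translates is large enough for the second-moment bound. Only n̄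
≥ 2m̄ is needed: it gives 2^n ≥ d²/x⁶, hence at least d/x⁶ translates as 2^t ≤ d, and Z^(2^t) ≥ Z^d
= x bounds each probability from below by x²/4. -/
theorem four_mul_le_of_nBar_lt {Z C P : ℝ} (hZ : Z ∈ Ioo (0 : ℝ) 1) (hP : P ∈ Ioo (0 : ℝ) 1)
    (hC : Real.log (1 - C) ≤ 0) {t n M : ℕ} (ht : (2 : ℝ) ^ t ≤ Real.log (P / 8) / Real.log Z)
    (hn : (2 : ℝ) ^ nBar Z C P < ((2 ^ n : ℕ) : ℝ)) (hM : M * 2 ^ t = 2 ^ n) {K : ℝ}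
    (hK : K * P ≤ 256) : 4 * K ≤ M * ((Z ^ 2 ^ t) ^ 2 / 4) := by
  have hd : 1 ≤ Real.log (P / 8) / Real.log Z := (one_le_pow₀ one_le_two).trans ht
  have hm := div_cube_le_two_rpow_mBar hZ hP hd
  have hx0 : 0 < P / 8 := by have := hP.1; positivity
  have hZt : P / 8 ≤ Z ^ 2 ^ t := by
    have h1 := Real.rpow_le_rpow_of_exponent_ge hZ.1 hZ.2.le ht
    have h2 := rpow_log_div_log hZ hx0 1
    rw [Nat.cast_one, one_mul, pow_one] at h2
    rw [h2] at h1
    exact_mod_cast h1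
  set x := P / 8 with hx
  set d := Real.log x / Real.log Z with hd'
  have hx1 : x ≤ 1 := by have := hP.2; rw [hx]; linarith
  have hnm : 2 * mBar Z P ≤ nBar Z C P := by
    unfold nBar
    have := Real.sqrt_nonneg (-4 * mBar Z P * Real.log (1 - C) + Real.log (1 - C) ^ 2)
    linarith
  have hN : (d / x ^ 3) ^ 2 ≤ (2 : ℝ) ^ n := by
    calc (d / x ^ 3) ^ 2 ≤ ((2 : ℝ) ^ mBar Z P) ^ 2 := by gcongr
      _ = (2 : ℝ) ^ (2 * mBar Z P) := by
        rw [mul_comm, Real.rpow_mul two_pos.le, Real.rpow_two]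
      _ ≤ (2 : ℝ) ^ nBar Z C P := Real.rpow_le_rpow_of_exponent_le one_le_two hnm
      _ ≤ (2 : ℝ) ^ n := by exact_mod_cast hn.le
  have hMt : (M : ℝ) * 2 ^ t = 2 ^ n := by exact_mod_cast hM
  have hMd : d / x ^ 6 ≤ M := by
    have h1 : d / x ^ 6 * d ≤ M * d := by
      calc d / x ^ 6 * d = (d / x ^ 3) ^ 2 := by field_simp
        _ ≤ (M : ℝ) * 2 ^ t := by rw [hMt]; exact hN
        _ ≤ M * d := by gcongr
    exact le_of_mul_le_mul_right h1 (by linarith)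
  have hM6 : 1 / x ^ 6 ≤ M := le_trans (by gcongr) hMd
  -- From Kx ≤ 256/8 = 32 and x³ ≤ 1/512, so that 16 · 32/512 = 1.
  calc 4 * K ≤ 1 / (4 * x ^ 4) := by
        rw [le_div_iff₀ (by positivity)]
        have h3 : x ^ 3 ≤ (1 / 8) ^ 3 :=
          pow_le_pow_left₀ hx0.le (by have := hP.2; rw [hx]; linarith) 3
        have hKx : K * x ≤ 32 := by rw [hx]; linarith
        calc 4 * K * (4 * x ^ 4) = 16 * (K * x) * x ^ 3 := by ring
          _ ≤ 16 * 32 * x ^ 3 := by gcongr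
          _ ≤ 16 * 32 * (1 / 8) ^ 3 := by gcongr
          _ = 1 := by norm_num
    _ = 1 / x ^ 6 * (x ^ 2 / 4) := by field_simp
    _ ≤ M * ((Z ^ 2 ^ t) ^ 2 / 4) := by gcongr

namespace BinaryChannel

/-- Either all nonzero codewords of a long polar code are unlikely to be confused with the
transmitted one, or list decoding fails with probability at least `1 / 2`. -/
theorem IsSymmetry.polar_dichotomy {Y : Type u} [MeasurableSpace Y] {W : BinaryChannel Y}
    {π : Y → Y} (h : W.IsSymmetry π) (hZ : W.bhattacharyya ∈ Ioo (0 : ℝ) 1)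
    (hcap : Real.log (1 - W.capacity) ≤ 0) {P : ℝ} (hP : P ∈ Ioo (0 : ℝ) 1) {n : ℕ}
    {C : Submodule (ZMod 2) ((Fin n → Fin 2) → ZMod 2)} (hC : IsPolarCode W n C)
    (hn : (2 : ℝ) ^ nBar W.bhattacharyya W.capacity P < ((2 ^ n : ℕ) : ℝ))
    {K : ℕ} (hK : 1 ≤ K) (hKP : K * P ≤ 256) :
    (∀ c ∈ C, c ≠ 0 → W.bhattacharyya ^ hammingNorm c ≤ P / 8) ∨
      1 / 2 ≤ (Measure.pi fun _ : Fin n → Fin 2 => W.ratioLaw).real (listErrorSet C K) := by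
  obtain ⟨A, hA, rfl⟩ := hC
  have hup := W.isUpperSet_of_syntheticBhattacharyya_le hZ hA
  have hx0 : 0 < P / 8 := by have := hP.1; positivity
  -- The dividing line is the minimum distance that makes every pairwise confusion probability at
  -- most P/8.
  by_cases hcase : ∀ b ∈ A, Real.log (P / 8) / Real.log W.bhattacharyya < (2 : ℝ) ^ onesCount b
  · exact Or.inl fun c hc hc0 =>
      pow_le_of_log_div_log_lt hZ hx0 (lt_hammingNorm_of_mem_span hcase hc hc0)
  · push Not at hcase
    obtain ⟨b, hb, hbd⟩ := hcase
    refine Or.inr (half_le_listErrorSet_of_subcube (b := b) W.ratioLaw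
      (p := (W.bhattacharyya ^ 2 ^ onesCount b) ^ 2 / 4)
      (fun a => subcubeIndicator_mem_span b a fun b' hbb' => hup hbb' hb)
      (fun a => ?_) hK ?_)
    · rw [← hammingNorm_subcubeIndicator b a]
      exact h.le_pi_confusionSet (subcubeIndicator b a)
    · exact four_mul_le_of_nBar_lt hZ hP hcap hbd hn (card_translates_mul b) hKP

end BinaryChannel

/-! ### Parameters of the erasure channel -/

section ErasureChannel

variable (ε : ℝ) (hε : ε ∈ Ioo (0 : ℝ) 1)

theorem isSymmetry_binaryErasureChannel :
    (binaryErasureChannel ε hε).IsSymmetry (Option.map (· + 1)) where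
  involutive y := by
    have h : ∀ a : ZMod 2, a + 1 + 1 = a := by decide
    cases y <;> simp [h]
  measurePreserving := by
    have hinv : Function.Involutive (Option.map (· + 1) : ErasureOutput → ErasureOutput) := by
      intro y
      have h : ∀ a : ZMod 2, a + 1 + 1 = a := by decide
      cases y <;> simp [h]
    refine ⟨measurable_from_top, ?_⟩
    change Measure.map _ Measure.count = Measure.count
    ext s hs
    rw [Measure.map_apply measurable_from_top hs, Measure.count_apply hs,
      Measure.count_apply (measurable_from_top hs), Set.encard_preimage_of_bijective hinv.bijective]
  p_one y := by
    rcases y with _ | b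
    · rfl
    · change (if b = 1 then (1 - ε).toNNReal else 0) = if b + 1 = 0 then (1 - ε).toNNReal else 0
      congr 1
      revert b
      decide

theorem binaryErasureChannel_p_none (x : ZMod 2) :
    (binaryErasureChannel ε hε).p x none = ε.toNNReal := rfl

theorem binaryErasureChannel_p_some (x b : ZMod 2) :
    (binaryErasureChannel ε hε).p x (some b) = if b = x then (1 - ε).toNNReal else 0 := rfl

theorem bhattacharyya_binaryErasureChannel : (binaryErasureChannel ε hε).bhattacharyya = ε := by
  change ∫ y, _ ∂(Measure.count : Measure ErasureOutput) = ε
  have : MeasurableSingletonClass ErasureOutput := ⟨fun _ => trivial⟩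
  rw [integral_count, Fintype.sum_option]
  have hsum : ∀ f : ZMod 2 → ℝ, ∑ u, f u = f 0 + f 1 := fun f => Fin.sum_univ_two f
  rw [hsum]
  simp [binaryErasureChannel_p_none, binaryErasureChannel_p_some, hε.1.le]

theorem likelihoodRatio_binaryErasureChannel (y : ErasureOutput) :
    (binaryErasureChannel ε hε).likelihoodRatio y = 0 ∨
      (binaryErasureChannel ε hε).likelihoodRatio y = 1 := by
  rcases y with _ | b
  · right
    rw [BinaryChannel.likelihoodRatio, binaryErasureChannel_p_none, binaryErasureChannel_p_none,
      div_self (by simpa using hε.1)]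
  · left
    rw [BinaryChannel.likelihoodRatio, binaryErasureChannel_p_some, binaryErasureChannel_p_some]
    rcases zmod_two_eq_zero_or_one b with rfl | rfl <;> simp

theorem ae_ratioLaw_binaryErasureChannel :
    ∀ᵐ r ∂(binaryErasureChannel ε hε).ratioLaw, r = 0 ∨ r = 1 := by
  rw [BinaryChannel.ratioLaw, ae_map_iff (BinaryChannel.measurable_likelihoodRatio _).aemeasurable]
  · exact Filter.Eventually.of_forall (likelihoodRatio_binaryErasureChannel ε hε)
  · exact (measurableSet_singleton 0).union (measurableSet_singleton 1)

theorem mutualInformation_binaryErasureChannel (q : ℝ) :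
    (binaryErasureChannel ε hε).mutualInformation q =
      (1 - ε) * (Real.negMulLog (1 - q) + Real.negMulLog q) / Real.log 2 := by
  change ∫ y, _ ∂(Measure.count : Measure ErasureOutput) = _
  have : MeasurableSingletonClass ErasureOutput := ⟨fun _ => trivial⟩
  have h1 : 0 < 1 - ε := sub_pos.2 hε.2
  rw [integral_count, Fintype.sum_option]
  have hsum : ∀ f : ZMod 2 → ℝ, ∑ u, f u = f 0 + f 1 := fun f => Fin.sum_univ_two f
  have hnone : (1 - q) * ε + q * ε = ε := by ring
  have hdiv : ∀ s : ℝ, (1 - ε) / (s * (1 - ε)) = s⁻¹ := fun s => by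
    rw [div_mul_cancel_right₀ h1.ne']
  rw [hsum]
  simp only [binaryErasureChannel_p_none, binaryErasureChannel_p_some, if_true,
    show (0 : ZMod 2) ≠ 1 by decide, show (1 : ZMod 2) ≠ 0 by decide, if_false,
    Real.coe_toNNReal _ hε.1.le, Real.coe_toNNReal _ h1.le, NNReal.coe_zero, mul_zero, add_zero,
    zero_add, zero_mul, hnone, div_self hε.1.ne', Real.log_one, hdiv, Real.logb, Real.log_inv,
    Real.negMulLog]
  ring

/-- `polar_dichotomy` needs only this sign. Since `Real.log` ignores the sign of its argument, the
crude bounds 0 ≤ C ≤ 2 suffice and the exact capacity is not required. -/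
theorem log_one_sub_capacity_binaryErasureChannel_nonpos :
    Real.log (1 - (binaryErasureChannel ε hε).capacity) ≤ 0 := by
  have h1 : 0 < 1 - ε := sub_pos.2 hε.2
  have hlog2 : 1 / 2 < Real.log 2 := by linarith [Real.log_two_gt_d9]
  have hle : ∀ q ∈ Icc (0 : ℝ) 1, Real.negMulLog q ≤ 1 - q := by
    intro q hq
    rcases hq.1.eq_or_lt with rfl | hq0
    · simp
    · have := Real.one_sub_inv_le_log_of_pos hq0
      have h2 := mul_le_mul_of_nonneg_left this hq0.le
      rw [mul_sub, mul_inv_cancel₀ hq0.ne'] at h2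
      unfold Real.negMulLog
      linarith
  have hnn : ∀ q : Icc (0 : ℝ) 1, 0 ≤ (binaryErasureChannel ε hε).mutualInformation q := by
    rintro ⟨q, hq⟩
    rw [mutualInformation_binaryErasureChannel]
    have ha := Real.negMulLog_nonneg hq.1 hq.2
    have hb := Real.negMulLog_nonneg (sub_nonneg.2 hq.2) (by linarith [hq.1] : 1 - q ≤ 1)
    positivity
  have htwo : ∀ q : Icc (0 : ℝ) 1, (binaryErasureChannel ε hε).mutualInformation q ≤ 2 := by
    rintro ⟨q, hq⟩
    rw [mutualInformation_binaryErasureChannel, div_le_iff₀ (by linarith)]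
    have ha := hle q hq
    have hb := hle (1 - q) ⟨sub_nonneg.2 hq.2, by linarith [hq.1]⟩
    have hc : Real.negMulLog (1 - q) + Real.negMulLog q ≤ 1 := by linarith
    have := hε.1
    nlinarith
  have hc0 : 0 ≤ (binaryErasureChannel ε hε).capacity := Real.iSup_nonneg hnn
  have hc2 : (binaryErasureChannel ε hε).capacity ≤ 2 := Real.iSup_le htwo two_pos.le
  rw [← Real.log_abs]
  exact Real.log_nonpos (abs_nonneg _) (abs_le.2 ⟨by linarith, by linarith⟩)

end ErasureChannel

/-! ### The threshold sequence and the conclusion -/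

theorem mem_Ioo_and_le_of_sq_recursion {P : ℕ → ℝ} (h0 : P 0 ∈ Ioo (0 : ℝ) 1)
    (hP : ∀ m, P (m + 1) = 3 / 16 * P m ^ 2) (m : ℕ) :
    P m ∈ Ioo (0 : ℝ) 1 ∧ P m ≤ (1 / 2) ^ m := by
  induction m with
  | zero => exact ⟨h0, by simpa using h0.2.le⟩
  | succ m ih =>
    obtain ⟨⟨h1, h2⟩, h3⟩ := ih
    have hle : P (m + 1) ≤ 1 / 2 * P m := by rw [hP]; nlinarith
    refine ⟨⟨by rw [hP]; positivity, by linarith⟩, hle.trans ?_⟩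
    rw [pow_succ, mul_comm]
    gcongr

/-- Settles the light-row case of the dichotomy, where the failure probability is already at least
1/2. -/
theorem pow_mul_pow_le_half {k : ℕ} (hk : 2 ≤ k) {p : ℝ} (hp0 : 0 ≤ p) (hp1 : p ≤ 1) :
    (3 / 16 : ℝ) ^ (k - 1) * p ^ k ≤ 1 / 2 := by
  have h1 : (3 / 16 : ℝ) ^ (k - 1) ≤ (3 / 16) ^ 1 :=
    pow_le_pow_of_le_one (by norm_num) (by norm_num) (by omega)
  have h2 : p ^ k ≤ 1 := pow_le_one₀ hp0 hp1
  calc _ ≤ (3 / 16 : ℝ) ^ 1 * 1 := by gcongr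
    _ ≤ 1 / 2 := by norm_num

theorem corollary1 :
    (∀ (Y : Type u) [MeasurableSpace Y] (W : BinaryChannel Y), W.IsSymmetric →
      W.capacity ∈ Ioo (0 : ℝ) 1 → W.bhattacharyya ∈ Ioo (0 : ℝ) 1 →
      ∀ Pe ∈ Ioo (0 : ℝ) 1, ∀ P : ℕ → ℝ, P 1 = Pe →
      (∀ m : ℕ, 1 ≤ m → P (m + 1) = 3 / 16 * P m ^ 2) →
      ∀ L : ℕ, 1 ≤ L →
        -- arbitrary linear codes
        (∀ (N : ℕ) (C : Submodule (ZMod 2) (Fin N → ZMod 2)),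
          W.mapErrorProb C L > P L →
          (minDistance C : ℝ) > Real.log (P L / 8) / Real.log W.bhattacharyya →
          W.mapErrorProb C (L + 1) ≥
            (3 / 16 : ℝ) ^ (2 ^ L - 1) * W.mapErrorProb C 1 ^ (2 ^ L)) ∧
        -- polar codes
        (∀ (n : ℕ) (C : Submodule (ZMod 2) ((Fin n → Fin 2) → ZMod 2)), IsPolarCode W n C →
          ((2 ^ n : ℕ) : ℝ) > (2 : ℝ) ^ nBar W.bhattacharyya W.capacity (P L) →
          W.mapErrorProb C L > P L →
          W.mapErrorProb C (L + 1) ≥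
            (3 / 16 : ℝ) ^ (2 ^ L - 1) * W.mapErrorProb C 1 ^ (2 ^ L))) ∧
    -- the binary erasure channel, with a list size `L` that is a power of two
    (∀ (ε : ℝ) (hε : ε ∈ Ioo (0 : ℝ) 1) (W : BinaryChannel ErasureOutput),
      W = binaryErasureChannel ε hε →
      ∀ Pe ∈ Ioo (0 : ℝ) 1, ∀ P : ℕ → ℝ, P 0 = Pe →
      (∀ m : ℕ, P (m + 1) = 3 / 16 * P m ^ 2) →
      ∀ l L : ℕ, L = 2 ^ l →
        -- arbitrary linear codes
        (∀ (N : ℕ) (C : Submodule (ZMod 2) (Fin N → ZMod 2)),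
          W.mapErrorProb C L > P l →
          (minDistance C : ℝ) > Real.log (P l / 8) / Real.log W.bhattacharyya →
          W.mapErrorProb C (2 * L) ≥
            (3 / 16 : ℝ) ^ (2 * L - 1) * W.mapErrorProb C 1 ^ (2 * L)) ∧
        -- polar codes
        (∀ (n : ℕ) (C : Submodule (ZMod 2) ((Fin n → Fin 2) → ZMod 2)), IsPolarCode W n C →
          ((2 ^ n : ℕ) : ℝ) > (2 : ℝ) ^ nBar W.bhattacharyya W.capacity (P l) →
          W.mapErrorProb C L > P l →
          W.mapErrorProb C (2 * L) ≥
            (3 / 16 : ℝ) ^ (2 * L - 1) * W.mapErrorProb C 1 ^ (2 * L))) := by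
  constructor
  · intro Y _ W hsym hcap hZ Pe hPe P hP1 hP L hL
    obtain ⟨π, hπ, hπm, hπp⟩ := hsym
    have h : W.IsSymmetry π := ⟨hπ, hπm, hπp⟩
    obtain ⟨k, rfl⟩ : ∃ k, L = k + 1 := ⟨L - 1, by omega⟩
    obtain ⟨hPL, hPle⟩ := mem_Ioo_and_le_of_sq_recursion (P := fun m => P (m + 1))
      (by simpa [hP1] using hPe) (fun m => hP (m + 1) (by omega)) k
    have hx0 : 0 < P (k + 1) / 8 := by have := hPL.1; positivity
    refine ⟨fun N C herr hd => ?_, fun n C hC hn herr => ?_⟩ <;>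
      rw [h.mapErrorProb_eq, gt_iff_lt] at herr <;>
      rw [h.mapErrorProb_eq, h.mapErrorProb_eq, ge_iff_le]
    · refine listErrorSet_iterate W.ratioLaw C herr fun c hc hc0 =>
        (W.pi_confusionSet_le c).trans (pow_le_of_log_div_log_lt hZ hx0 (hd.lt.trans_le ?_))
      exact_mod_cast minDistance_le_hammingNorm hc hc0
    -- The dichotomy is applied at the target list size L + 1; the thresholds decay at least like
    -- 2^(−k), which outweighs the linear growth of the list.
    · have hKP : ((k + 1 + 1 : ℕ) : ℝ) * P (k + 1) ≤ 256 := by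
        have h1 : ((k + 1 + 1 : ℕ) : ℝ) ≤ 2 ^ (k + 2) := by
          exact_mod_cast (show k + 1 + 1 ≤ 2 ^ (k + 2) from Nat.lt_two_pow_self.le)
        calc _ ≤ (2 : ℝ) ^ (k + 2) * (1 / 2) ^ k := by
              gcongr
              exact hPL.1.le
          _ = 4 := by rw [pow_add, one_div, inv_pow]; field_simp; norm_num
          _ ≤ 256 := by norm_num
      rcases h.polar_dichotomy hZ (Real.log_nonpos (by linarith [hcap.2]) (by linarith [hcap.1]))
        hPL hC hn (by omega) hKP with hs | hs
      · exact listErrorSet_iterate W.ratioLaw C herr fun c hc hc0 =>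
          (W.pi_confusionSet_le c).trans (hs c hc hc0)
      · exact (pow_mul_pow_le_half (le_self_pow₀ one_le_two (by omega)) measureReal_nonneg
          measureReal_le_one).trans hs
  · rintro ε hε W rfl Pe hPe P hP0 hP l L rfl
    have h := isSymmetry_binaryErasureChannel ε hε
    have hμ := ae_ratioLaw_binaryErasureChannel ε hε
    have hZ : (binaryErasureChannel ε hε).bhattacharyya ∈ Ioo (0 : ℝ) 1 := by
      rwa [bhattacharyya_binaryErasureChannel]
    obtain ⟨hPl, hPle⟩ := mem_Ioo_and_le_of_sq_recursion (by rwa [hP0]) hP l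
    have hx0 : 0 < P l / 8 := by have := hPl.1; positivity
    rw [← pow_succ']
    refine ⟨fun N C herr hd => ?_, fun n C hC hn herr => ?_⟩ <;>
      rw [h.mapErrorProb_eq, gt_iff_lt] at herr <;>
      rw [h.mapErrorProb_eq, h.mapErrorProb_eq, ge_iff_le]
    · refine listErrorSet_two_pow_iterate _ C hμ herr fun c hc hc0 =>
        (BinaryChannel.pi_confusionSet_le _ c).trans
          (pow_le_of_log_div_log_lt hZ hx0 (hd.lt.trans_le ?_))
      exact_mod_cast minDistance_le_hammingNorm hc hc0
    -- Here the target list size 2L doubles with each step, while the threshold at least halves.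
    · have hKP : ((2 ^ (l + 1) : ℕ) : ℝ) * P l ≤ 256 := by
        calc _ ≤ (2 : ℝ) ^ (l + 1) * (1 / 2) ^ l := by push_cast; gcongr
          _ = 2 := by rw [pow_add, one_div, inv_pow]; field_simp
          _ ≤ 256 := by norm_num
      rcases h.polar_dichotomy hZ (log_one_sub_capacity_binaryErasureChannel_nonpos ε hε)
        hPl hC hn Nat.one_le_two_pow hKP with hs | hs
      · exact listErrorSet_two_pow_iterate _ C hμ herr fun c hc hc0 =>
          (BinaryChannel.pi_confusionSet_le _ c).trans (hs c hc hc0)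
      · exact (pow_mul_pow_le_half (le_self_pow₀ one_le_two (by omega)) measureReal_nonneg
          measureReal_le_one).trans hs
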